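/- **Setting.** Let $\Omega\subset\mathbb R^2$ be a bounded polygonal domain with Lipschitz boundary, $u(x_1,x_2)=x_1^2+x_2^2$, $\alpha\in[0,1]$ and $M>0$. Let $H\subset(0,\infty)$ (for instance $H=(0,h_0)$) and let $\{\mathcal T_h\}_{h\in H}$ be conforming triangulations of $\Omega$, where $h$ is the maximal diameter of the triangles of $\mathcal T_h$. Let $X_h$ be the space of continuous functions on $\overline\Omega$ that are affine on each triangle of $\mathcal T_h$, and let $|v|_1=(\int_\Omega|\nabla v|^2)^{1/2}$. Suppose that for every $h\in H$ there is $U_h\in X_h$ (e.g. the finite element solution) with $$|u-U_h|_1\le M h^\alpha .\tag{E}$$ A *band* $\mathcal B\subset\mathcal T_h$ consists of triangles $K_i=p_ip_{i+1}q_i$ ($0\le i\le N$) and $\tilde K_i=q_{i-1}q_ip_i$ ($1\le i\le N$) of $\mathcal T_h$, $N\ge1$, such that the segments $p_ip_{i+1}$, which are longest edges of the $K_i$, follow one another in one direction on a straight line, and the maximum angle $\tilde\alpha_i$ of $\tilde K_i$ is at $p_i$. Let $\alpha_i$ be the maximum angle of $K_i$ (it is at $q_i$), $|K|$ the area of $K$,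 and $L=|p_0-p_{N+1}|$ the length of the band. Bands are *disjoint* if they have no triangle in common; quantities of a band $\mathcal B_b$ carry the index $b$. **Statement.** There is $C_L>0$, depending only on $\Omega,\alpha,M$, such that the following holds. 1. For all $C_K,C_\alpha>0$ there is $C>0$, depending only on $\Omega,\alpha,M,C_K,C_\alpha$, such that for all families $\{\mathcal T_h\}_{h\in H}$ satisfying (E), all $h\in H$, and all finite families of disjoint bands $\mathcal B_1,\dots,\mathcal B_{N_{\mathcal B}}\subset\mathcal T_h$ with $$|\tilde K_i^b|\le C_K|K_i^b|,\quad |\tilde K_i^b|\le C_K|K_{i-1}^b|,\quad \sin(\pi-\alpha_{i-1}^b)\le C_\alpha\sin(\pi-\tilde\alpha_i^b)\quad(1\le i\le N_b)$$ and $L_b\ge C_Lh^{2\alpha/5}$ for all $b$, one has $$\Big(\sum_{b=1}^{N_{\mathcal B}}\min_{1\le i\le N_b}\frac1{\sin^2(\pi-\tilde\alpha_i^b)}\ \min_{1\le i\le N_b}|\tilde K_i^b|\ L_b^2N_b^{-1}\Big)^{1/2}\le C h^\alpha .$$ 2. (Babuška–Aziz-type meshes.) There is $c>0$, depending only on $\Omega,\alpha,M$,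 such that for all families satisfying (E) and all $h\in H$: if $\mathcal T_h$ contains $N_{\mathcal B}$ disjoint bands, all of length $L\ge C_Lh^{2\alpha/5}$ and consisting of identical isosceles triangles with base length $h$ and height $\bar h$, where $N_{\mathcal B}\bar h=L$, then $$\bar h\ge c\,h^{2-\alpha}L .$$ 3. (Babuška–Aziz-type meshes, lengths bounded below.) If $\alpha>0$ and $\ell>0$, there are $c,h_1>0$, depending only on $\Omega,\alpha,M,\ell$, such that for all families satisfying (E) and all $h\in H$ with $h<h_1$: if $\mathcal T_h$ contains bands as in part 2, but with $L\ge\ell$ in place of $L\ge C_Lh^{2\alpha/5}$, then $\bar h\ge c\,h^{2-\alpha}$. -/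

import Mathlib

noncomputable section

namespace BandFEM

/-- The Euclidean plane. -/
abbrev Plane : Type := EuclideanSpace ℝ (Fin 2)

/-- `Ω` is a bounded polygonal domain with Lipschitz boundary: a nonempty, open, connected, bounded
set whose boundary is a finite union of line segments and is locally, in suitable orthonormal
coordinates, the graph of a Lipschitz function with `Ω` lying on one side of that graph. -/
structure IsPolygonalLipschitzDomain (Ω : Set Plane) : Prop where
  isOpen : IsOpen Ω
  isConnected : IsConnected Ω
  isBounded : Bornology.IsBounded Ω
  polygonal : ∃ S : Finset (Plane × Plane), frontier Ω = ⋃ e ∈ S, segment ℝ e.1 e.2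
  lipschitz : ∀ x ∈ frontier Ω, ∃ (R : Plane ≃ₗᵢ[ℝ] Plane) (r : ℝ) (γ : ℝ → ℝ) (K : NNReal),
    0 < r ∧ LipschitzWith K γ ∧ ∀ y ∈ Metric.ball x r, y ∈ Ω ↔ γ (R y 0) < R y 1

/-- Conforming collections of simplices in the plane. Conformity (two simplices meet in the convex
hull of their common vertices) is part of Mathlib's notion of a simplicial complex. -/
abbrev Complex2 : Type := Geometry.SimplicialComplex ℝ Plane

/-- The vertex sets of the elements (triangles) of `𝒯`. -/
def elements (𝒯 : Complex2) : Set (Set Plane) :=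
  {T | ∃ s ∈ 𝒯.faces, s.card = 3 ∧ T = (s : Set Plane)}

/-- `𝒯` is a conforming triangulation of `Ω` into finitely many (closed, nondegenerate) triangles
whose maximal diameter is `h`. -/
structure IsTriangulation (Ω : Set Plane) (𝒯 : Complex2) (h : ℝ) : Prop where
  finite : 𝒯.faces.Finite
  pure : ∀ s ∈ 𝒯.faces, ∃ t ∈ 𝒯.faces, s ⊆ t ∧ t.card = 3
  space_eq : 𝒯.space = closure Ω
  meshSize : IsGreatest {d | ∃ T ∈ elements 𝒯, d = Metric.diam (convexHull ℝ T)} h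

/-- The piecewise linear finite element space `X_h`: functions that are continuous on the
triangulated set and affine on each triangle. The values off the triangulated set are irrelevant. -/
def feSpace (𝒯 : Complex2) : Set (Plane → ℝ) :=
  {U | ContinuousOn U 𝒯.space ∧
    ∀ T ∈ elements 𝒯, ∃ A : Plane →ᵃ[ℝ] ℝ, Set.EqOn U A (convexHull ℝ T)}

/-- The seminorm `|v|_{H¹(Ω)} = (∫_Ω |∇v|²)^{1/2}`. It is only used for the difference of a
polynomial and a continuous piecewise affine function, whose weak gradient is the classical
gradient, defined almost everywhere (the norm of the Fréchet derivative is that of the gradient). -/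
def h1Seminorm (Ω : Set Plane) (v : Plane → ℝ) : ℝ :=
  Real.sqrt (∫ x in Ω, ‖fderiv ℝ v x‖ ^ 2)

/-- The exact solution `u(x₁, x₂) = x₁² + x₂²`. -/
def quadFun (x : Plane) : ℝ := x 0 ^ 2 + x 1 ^ 2

/-- The error estimate `|u - U|_{H¹(Ω)} ≤ M h^α`, for all mesh sizes `h ∈ H`, where
`u = x₁² + x₂²` and `U = U h ∈ X_h` is some discrete function (for instance the finite element
solution) on the mesh `𝒯 h`. -/
def ErrorEstimate (Ω : Set Plane) (H : Set ℝ) (𝒯 : ℝ → Complex2) (α M : ℝ) : Prop :=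
  ∃ U : ℝ → Plane → ℝ, ∀ h ∈ H, U h ∈ feSpace (𝒯 h) ∧
    h1Seminorm Ω (fun x => quadFun x - U h x) ≤ M * h ^ α

/-- A family of triangulations of `Ω`, indexed by their mesh sizes `h ∈ H`, with `H ⊆ (0, ∞)`. -/
def IsTriangulationFamily (Ω : Set Plane) (H : Set ℝ) (𝒯 : ℝ → Complex2) : Prop :=
  ∀ h ∈ H, 0 < h ∧ IsTriangulation Ω (𝒯 h) h

/-- The maximum angle of the triangle `abc`. -/
def maxAngle (a b c : Plane) : ℝ :=
  max (EuclideanGeometry.angle b a c)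
    (max (EuclideanGeometry.angle a b c) (EuclideanGeometry.angle a c b))

/-- The area of the triangle `abc`. -/
def area (a b c : Plane) : ℝ :=
  MeasureTheory.volume.real (convexHull ℝ {a, b, c})

/-- A (straight) band in `𝒯`, consisting of the triangles
`K i = p i, p (i+1), q i` for `0 ≤ i ≤ N` and `K̃ (i+1) = q i, q (i+1), p (i+1)` for `0 ≤ i < N`,
with `N ≥ 1`. So consecutive triangles `K i, K̃ (i+1), K (i+1)` are neighbours through the edges
`q i, p (i+1)` and `p (i+1), q (i+1)`. The longest edges `p i, p (i+1)` of the triangles `K i` follow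
one another on a line, in the direction of the unit vector `g`, and form the edge `Γ` of the band.
The maximum angles alternate between the two sides of the band: that of `K i` is at `q i`
(opposite to its longest edge) and that of `K̃ (i+1)` is at `p (i+1)`, on `Γ`.
The values `p i` for `i > N + 1` and `q i` for `i > N` play no role. -/
structure Band (𝒯 : Complex2) where
  N : ℕ
  one_le_N : 1 ≤ N
  p : ℕ → Plane
  q : ℕ → Plane
  g : Plane
  norm_g : ‖g‖ = 1
  elem_mem : ∀ i ≤ N, {p i, p (i + 1), q i} ∈ elements 𝒯
  elem'_mem : ∀ i < N, {q i, q (i + 1), p (i + 1)} ∈ elements 𝒯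
  straight : ∀ i ≤ N, p (i + 1) = p i + dist (p i) (p (i + 1)) • g
  longest : ∀ i ≤ N, dist (p i) (q i) ≤ dist (p i) (p (i + 1)) ∧
    dist (p (i + 1)) (q i) ≤ dist (p i) (p (i + 1))
  maxAngle_eq' : ∀ i < N, EuclideanGeometry.angle (q i) (p (i + 1)) (q (i + 1)) =
    maxAngle (q i) (q (i + 1)) (p (i + 1))

namespace Band

variable {𝒯 : Complex2} (B : Band 𝒯)

/-- The set of (vertex sets of) all triangles of the band. -/
def elems : Set (Set Plane) :=
  {T | (∃ i ≤ B.N, T = {B.p i, B.p (i + 1), B.q i}) ∨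
    ∃ i < B.N, T = {B.q i, B.q (i + 1), B.p (i + 1)}}

/-- The length `L` of the band, that is, of its edge `Γ`. -/
def length : ℝ := dist (B.p 0) (B.p (B.N + 1))

/-- The maximum angle `α i` of `K i`, `0 ≤ i ≤ N`. -/
def ang (i : ℕ) : ℝ := maxAngle (B.p i) (B.p (i + 1)) (B.q i)

/-- The maximum angle of `K̃ (i+1)`, `0 ≤ i < N`. -/
def ang' (i : ℕ) : ℝ := maxAngle (B.q i) (B.q (i + 1)) (B.p (i + 1))

/-- The area of `K i`, `0 ≤ i ≤ N`. -/
def areaK (i : ℕ) : ℝ := area (B.p i) (B.p (i + 1)) (B.q i)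

/-- The area of `K̃ (i+1)`, `0 ≤ i < N`. -/
def areaK' (i : ℕ) : ℝ := area (B.q i) (B.q (i + 1)) (B.p (i + 1))

/-- The assumptions on the shape of neighbouring triangles of a band:
`|K̃ i| ≤ C_K |K i|`, `|K̃ i| ≤ C_K |K (i-1)|` and `sin (π - α (i-1)) ≤ C_α sin (π - α̃ i)` for
`i = 1, …, N`. -/
def IsAdmissible (C_K C_α : ℝ) : Prop :=
  ∀ i < B.N, B.areaK' i ≤ C_K * B.areaK (i + 1) ∧ B.areaK' i ≤ C_K * B.areaK i ∧
    Real.sin (Real.pi - B.ang i) ≤ C_α * Real.sin (Real.pi - B.ang' i)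

/-- The contribution `min_i sin⁻² (π - α̃ i) · min_i |K̃ i| · L² · N⁻¹` of one band. The two infima
are over the finite nonempty range `i = 1, …, N`, hence minima. -/
def weight : ℝ :=
  (⨅ i : Fin B.N, 1 / Real.sin (Real.pi - B.ang' i) ^ 2) * (⨅ i : Fin B.N, B.areaK' i) *
    B.length ^ 2 * (B.N : ℝ)⁻¹

end Band

/-- The bands of the family have no triangle in common. -/
def DisjointBands {𝒯 : Complex2} {n : ℕ} (B : Fin n → Band 𝒯) : Prop :=
  Pairwise fun b b' => Disjoint (B b).elems (B b').elems

/-- The triangle `abc` is isosceles with base `ab` of length `base` and with height `height`. -/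
def IsIsosceles (a b c : Plane) (base height : ℝ) : Prop :=
  dist a b = base ∧ dist a c = dist b c ∧ dist (midpoint ℝ a b) c = height

/-- A set of bands of Babuška–Aziz type: `n` disjoint bands of the same length `L` which consist of
identical isosceles triangles with base length `h` and height `hbar`, where `n * hbar = L`.
(This holds if the bands are stacked so as to fill the height `L`, as in the Babuška–Aziz mesh, but
the bands need not lie next to each other.) -/
structure IsBabuskaAziz {𝒯 : Complex2} {n : ℕ} (B : Fin n → Band 𝒯) (h hbar L : ℝ) : Prop where
  disjoint : DisjointBands B
  isosceles : ∀ b, ∀ i ≤ (B b).N, IsIsosceles ((B b).p i) ((B b).p (i + 1)) ((B b).q i) h hbar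
  isosceles' : ∀ b, ∀ i < (B b).N,
    IsIsosceles ((B b).q i) ((B b).q (i + 1)) ((B b).p (i + 1)) h hbar
  length_eq : ∀ b, (B b).length = L
  count : (n : ℝ) * hbar = L

end BandFEM

end

/-! Let `w` be the piecewise gradient of `U` and, for the `i`-th triangle `K̃` of a band, let
`aᵢ` be the change of the derivative of `U` along the edge `Γ` from the triangle before `K̃`
to the one after it. If `∑ |aᵢ|` were small compared to `L`, then `U` would be almost linear
on a piece of `Γ` of length comparable to `L`, on which `u` has a second difference of order
`L²`. Such a piece is a side of a parallelogram inside `Ω` with other side of comparable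
length, because `∂Ω` is Lipschitz, and a trace estimate there, tested against a Legendre
polynomial in order to get rid of linear functions, yields `L² ≲ |u - U|₁`. So `∑ |aᵢ| ≳ L` on
bands with `L² ≫ |u - U|₁`.

On the other hand `w` jumps across an edge of the mesh only in the normal direction, and the
two edges of `K̃` at its vertex on `Γ` make an angle of order `sin (π - α̃ᵢ)` with `Γ`. So
`|aᵢ| ≲ sin (π - α̃ᵢ) · (sum of |w - ∇u| over the three triangles)`, and the local energy of
`u - U` on a triangle `K` controls `|K| · |w - ∇u|²`. The estimate follows by the
Cauchy-Schwarz inequality on each band and summation over the disjoint bands. -/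

noncomputable section

namespace BandFEM

open MeasureTheory Set Real Topology InnerProductGeometry
open scoped EuclideanGeometry

section Angles

variable {V : Type*} [NormedAddCommGroup V] [InnerProductSpace ℝ V]

lemma norm_sub_smul_eq_mul_sin_angle (v g : V) :
    ‖g - (inner ℝ v g / ‖v‖ ^ 2) • v‖ = ‖g‖ * sin (angle v g) := by
  have hsq : ‖g - (inner ℝ v g / ‖v‖ ^ 2) • v‖ ^ 2 = ‖g‖ ^ 2 * (1 - cos (angle v g) ^ 2) := by
    rw [norm_sub_sq_real, inner_smul_right, norm_smul, mul_pow, norm_eq_abs, sq_abs, cos_angle]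
    rcases eq_or_ne v 0 with rfl | hv
    · simp
    rcases eq_or_ne g 0 with rfl | hg
    · simp
    rw [real_inner_comm v g]
    field_simp
    ring
  rw [← sin_sq, ← mul_pow] at hsq
  exact (sq_eq_sq₀ (norm_nonneg _)
    (mul_nonneg (norm_nonneg _) (sin_angle_nonneg v g))).mp hsq

lemma norm_mul_sin_angle_le (v g : V) (t : ℝ) : ‖g‖ * sin (angle v g) ≤ ‖g - t • v‖ := by
  rw [← norm_sub_smul_eq_mul_sin_angle]
  set c := inner ℝ v g / ‖v‖ ^ 2 with hc
  have horth : inner ℝ (g - c • v) ((c - t) • v) = 0 := by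
    rcases eq_or_ne v 0 with rfl | hv
    · simp
    rw [inner_smul_right, inner_sub_left, inner_smul_left, real_inner_self_eq_norm_sq,
      real_inner_comm, hc]
    simp [norm_ne_zero_iff.mpr hv]
  have hpyth := norm_add_sq_eq_norm_sq_add_norm_sq_real horth
  rw [show g - c • v + (c - t) • v = g - t • v by module] at hpyth
  nlinarith [norm_nonneg (g - c • v), norm_nonneg (g - t • v), norm_nonneg ((c - t) • v)]

lemma sin_angle_le_add (x y z : V) :
    sin (angle x z) ≤ sin (angle x y) + sin (angle y z) := by
  have hxy := sin_angle_nonneg x y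
  have hyz := sin_angle_nonneg y z
  rcases eq_or_ne y 0 with rfl | hy
  · simpa using (sin_le_one _).trans (by norm_num)
  rcases eq_or_ne z 0 with rfl | hz
  · simpa using hxy
  set b := inner ℝ y z / ‖y‖ ^ 2 with hb
  set a := inner ℝ x y / ‖x‖ ^ 2
  have hby : |b| * ‖y‖ ≤ ‖z‖ := by
    have := norm_pos_iff.mpr hy
    rw [hb, abs_div, abs_of_pos (by positivity : 0 < ‖y‖ ^ 2), div_mul_eq_mul_div,
      div_le_iff₀ (by positivity)]
    nlinarith [abs_real_inner_le_norm y z]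
  refine le_of_mul_le_mul_left ?_ (norm_pos_iff.mpr hz)
  calc ‖z‖ * sin (angle x z) ≤ ‖z - (b * a) • x‖ := norm_mul_sin_angle_le x z _
    _ = ‖(z - b • y) + b • (y - a • x)‖ := by congr 1; module
    _ ≤ ‖z - b • y‖ + |b| * ‖y - a • x‖ := by
      simpa only [norm_smul, norm_eq_abs] using norm_add_le (z - b • y) (b • (y - a • x))
    _ = ‖z‖ * sin (angle y z) + |b| * ‖y‖ * sin (angle x y) := by
      rw [norm_sub_smul_eq_mul_sin_angle, norm_sub_smul_eq_mul_sin_angle, mul_assoc]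
    _ ≤ ‖z‖ * sin (angle y z) + ‖z‖ * sin (angle x y) := by gcongr
    _ = ‖z‖ * (sin (angle x y) + sin (angle y z)) := by ring

lemma abs_inner_le_mul_sin_angle {z v : V} (g : V) (hzv : inner ℝ z v = 0) :
    |inner ℝ z g| ≤ ‖z‖ * (‖g‖ * sin (angle v g)) := by
  rw [← norm_sub_smul_eq_mul_sin_angle]
  simpa [inner_sub_right, inner_smul_right, hzv] using
    abs_real_inner_le_norm z (g - (inner ℝ v g / ‖v‖ ^ 2) • v)

/-- Writing `S` for the sine of the angle at `p` between the two edges `p q₀`, `p q₁` along which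
a gradient changes from `w₀` to `w` to `w₁`, the jump of the derivative across both edges in a
direction `g` nearly parallel to them is of order `S`. -/
lemma abs_inner_sub_le_of_orthogonal {g v₀ v₁ w₀ w w₁ : V} {S C : ℝ} (hg : ‖g‖ = 1)
    (h₀ : inner ℝ (w - w₀) v₀ = 0) (h₁ : inner ℝ (w - w₁) v₁ = 0)
    (hS : sin (angle v₀ v₁) = S) (hC : sin (angle v₀ g) ≤ C * S) :
    |inner ℝ (w₁ - w₀) g| ≤ S * (C * ‖w - w₀‖ + (1 + C) * ‖w - w₁‖) := by
  have hv₁ : sin (angle v₁ g) ≤ S + C * S := by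
    have := sin_angle_le_add v₁ v₀ g
    rw [angle_comm v₁ v₀, hS] at this
    linarith
  have k₀ := abs_inner_le_mul_sin_angle g h₀
  have k₁ := abs_inner_le_mul_sin_angle g h₁
  rw [hg, one_mul] at k₀ k₁
  calc |inner ℝ (w₁ - w₀) g| = |inner ℝ (w - w₀) g - inner ℝ (w - w₁) g| := by
        rw [← inner_sub_left, sub_sub_sub_cancel_left]
    _ ≤ |inner ℝ (w - w₀) g| + |inner ℝ (w - w₁) g| := abs_sub _ _
    _ ≤ ‖w - w₀‖ * (C * S) + ‖w - w₁‖ * (S + C * S) := by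
      refine add_le_add (k₀.trans ?_) (k₁.trans ?_) <;> gcongr
    _ = S * (C * ‖w - w₀‖ + (1 + C) * ‖w - w₁‖) := by ring

end Angles

lemma sin_le_sin_of_le_pi_sub {x m : ℝ} (h0 : 0 ≤ x) (hxm : x ≤ m) (hm : m ≤ π - x) :
    sin x ≤ sin m := by
  rcases le_total m (π / 2) with h | h
  · exact sin_le_sin_of_le_of_le_pi_div_two (by linarith [pi_pos]) h hxm
  · rw [← sin_pi_sub m]
    exact sin_le_sin_of_le_of_le_pi_div_two (by linarith [pi_pos]) (by linarith) (by linarith)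

lemma sin_angle_le_sin_maxAngle {a b c : Plane} (hab : a ≠ b) :
    sin (∠ a b c) ≤ sin (maxAngle a b c) := by
  have hsum := EuclideanGeometry.angle_add_angle_add_angle_eq_pi c hab.symm
  have hb := EuclideanGeometry.angle_nonneg a b c
  have hc := EuclideanGeometry.angle_nonneg b c a
  have ha := EuclideanGeometry.angle_nonneg c a b
  rw [EuclideanGeometry.angle_comm b c a] at hsum hc
  rw [EuclideanGeometry.angle_comm c a b] at hsum ha
  have hle : ∠ a b c ≤ maxAngle a b c := (le_max_left _ _).trans (le_max_right _ _)
  have hcases : maxAngle a b c = ∠ b a c ∨ maxAngle a b c = ∠ a b c ∨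
      maxAngle a b c = ∠ a c b := by
    unfold maxAngle
    grind
  rcases hcases with h | h | h
  · exact sin_le_sin_of_le_pi_sub hb hle (by linarith)
  · rw [h]
  · exact sin_le_sin_of_le_pi_sub hb hle (by linarith)

section Convex

variable {E F : Type*} [NormedAddCommGroup E] [NormedSpace ℝ E]
  [NormedAddCommGroup F] [NormedSpace ℝ F]

lemma sq_norm_map_le_homothety (f : E →ᵃ[ℝ] F) (p x : E) :
    ‖f p‖ ^ 2 ≤ 8 * ‖f (AffineMap.homothety p (1 / 2 : ℝ) x)‖ ^ 2 + 2 * ‖f x‖ ^ 2 := by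
  have hf : f p = (2 : ℝ) • f (AffineMap.homothety p (1 / 2 : ℝ) x) - f x := by
    rw [AffineMap.homothety_eq_lineMap, AffineMap.apply_lineMap, AffineMap.lineMap_apply_module]
    module
  have hle := norm_sub_le ((2 : ℝ) • f (AffineMap.homothety p (1 / 2 : ℝ) x)) (f x)
  rw [← hf, norm_smul, norm_ofNat] at hle
  nlinarith [norm_nonneg (f p), sq_nonneg
    (2 * ‖f (AffineMap.homothety p (1 / 2 : ℝ) x)‖ - ‖f x‖)]

variable [MeasurableSpace E] [BorelSpace E] [FiniteDimensional ℝ E] (μ : Measure E)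
  [μ.IsAddHaarMeasure]

lemma integrableOn_comp_homothety_and_integral_le {C : Set E} (hC : Convex ℝ C)
    (hCm : MeasurableSet C) {p : E} (hp : p ∈ C) {φ : E → ℝ} (hφ : IntegrableOn φ C μ)
    (hφ0 : ∀ x, 0 ≤ φ x) :
    IntegrableOn (fun x => φ (AffineMap.homothety p (1 / 2 : ℝ) x)) C μ ∧
      ∫ x in C, φ (AffineMap.homothety p (1 / 2 : ℝ) x) ∂μ ≤
        2 ^ Module.finrank ℝ E * ∫ x in C, φ x ∂μ := by
  set H := AffineMap.homothety p (1 / 2 : ℝ) with hH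
  set D : E →L[ℝ] E := (1 / 2 : ℝ) • ContinuousLinearMap.id ℝ E with hD
  have hderiv : ∀ x ∈ C, HasFDerivWithinAt H D C x := fun x _ => by
    simp only [hH, AffineMap.coe_homothety, vsub_eq_sub, vadd_eq_add]
    exact ((((hasFDerivAt_id x).sub_const p).const_smul (1 / 2 : ℝ)).add_const p).hasFDerivWithinAt
  have hinj : InjOn H C := fun x _ y _ hxy => by
    simpa [hH, AffineMap.homothety_apply] using hxy
  have hmaps : H '' C ⊆ C := by
    rintro _ ⟨x, hx, rfl⟩
    rw [hH, AffineMap.homothety_eq_lineMap]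
    exact hC.lineMap_mem hp hx ⟨by norm_num, by norm_num⟩
  have hdet : |D.det| = (2 ^ Module.finrank ℝ E)⁻¹ := by
    simp [hD, ContinuousLinearMap.det]
  have hint := (integrableOn_image_iff_integrableOn_abs_det_fderiv_smul μ hCm hderiv hinj φ).mp
    (hφ.mono_set hmaps)
  have heq := integral_image_eq_integral_abs_det_fderiv_smul μ hCm hderiv hinj φ
  simp only [hdet, smul_eq_mul] at hint heq
  rw [integral_const_mul] at heq
  refine ⟨(integrable_const_mul_iff (by simp) _).mp hint, ?_⟩
  rw [← inv_mul_le_iff₀ (by positivity), ← heq]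
  exact setIntegral_mono_set hφ (.of_forall hφ0) hmaps.eventuallyLE

lemma measureReal_mul_sq_norm_le {C : Set E} (hC : Convex ℝ C) (hCm : MeasurableSet C) {p : E}
    (hp : p ∈ C) (f : E →ᵃ[ℝ] F) (hf : IntegrableOn (fun x => ‖f x‖ ^ 2) C μ) :
    μ.real C * ‖f p‖ ^ 2 ≤ (8 * 2 ^ Module.finrank ℝ E + 2) * ∫ x in C, ‖f x‖ ^ 2 ∂μ := by
  obtain ⟨hint, hle⟩ := integrableOn_comp_homothety_and_integral_le μ hC hCm hp hf fun x =>
    sq_nonneg ‖f x‖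
  calc μ.real C * ‖f p‖ ^ 2 = ∫ _ in C, ‖f p‖ ^ 2 ∂μ := by rw [setIntegral_const, smul_eq_mul]
    _ ≤ ∫ x in C, (8 * ‖f (AffineMap.homothety p (1 / 2 : ℝ) x)‖ ^ 2 + 2 * ‖f x‖ ^ 2) ∂μ :=
      integral_mono_of_nonneg (.of_forall fun _ => sq_nonneg _)
        ((hint.const_mul 8).add (hf.const_mul 2))
        (.of_forall (sq_norm_map_le_homothety f p))
    _ = 8 * (∫ x in C, ‖f (AffineMap.homothety p (1 / 2 : ℝ) x)‖ ^ 2 ∂μ) +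
        2 * ∫ x in C, ‖f x‖ ^ 2 ∂μ := by
      rw [integral_add (hint.const_mul 8) (hf.const_mul 2), integral_const_mul, integral_const_mul]
    _ ≤ (8 * 2 ^ Module.finrank ℝ E + 2) * ∫ x in C, ‖f x‖ ^ 2 ∂μ := by linarith

end Convex

section ConvexLine

variable {E : Type*} [NormedAddCommGroup E] [NormedSpace ℝ E]

lemma not_three_mem_frontier_of_null {C : Set E} (hC : Convex ℝ C) {x v : E}
    (hnull : volume {t : ℝ | x + t • v ∈ frontier C} = 0) {r s t : ℝ} (hrs : r < s) (hst : s < t)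
    (hr : x + r • v ∈ frontier C) (hs : x + s • v ∈ frontier C) : x + t • v ∉ frontier C := by
  intro ht
  have hcomb : ∀ {a b c : ℝ}, c ∈ openSegment ℝ a b →
      x + c • v ∈ openSegment ℝ (x + a • v) (x + b • v) := by
    rintro a b c ⟨m, n, hm, hn, hmn, rfl⟩
    obtain rfl : n = 1 - m := by linarith
    exact ⟨m, 1 - m, hm, hn, hmn, by module⟩
  have hint : ∀ u, x + u • v ∉ interior C := fun u hui => hs.2 <| by
    rcases lt_trichotomy u s with hus | rfl | hsu
    · exact hC.openSegment_interior_closure_subset_interior hui ht.1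
        (hcomb (by rw [openSegment_eq_Ioo (hus.trans hst)]; exact ⟨hus, hst⟩))
    · exact hui
    · exact hC.openSegment_closure_interior_subset_interior hr.1 hui
        (hcomb (by rw [openSegment_eq_Ioo (hrs.trans hsu)]; exact ⟨hrs, hsu⟩))
  have hsub : Ioo r t ⊆ {t : ℝ | x + t • v ∈ frontier C} := fun u hu =>
    ⟨hC.closure.openSegment_subset hr.1 ht.1
      (hcomb (by rwa [openSegment_eq_Ioo (hrs.trans hst)])), hint u⟩
  have hvol := measure_mono_null hsub hnull
  rw [Real.volume_Ioo, ENNReal.ofReal_eq_zero] at hvol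
  linarith

lemma finite_line_inter_frontier_of_null {C : Set E} (hC : Convex ℝ C) {x v : E}
    (hnull : volume {t : ℝ | x + t • v ∈ frontier C} = 0) :
    {t : ℝ | x + t • v ∈ frontier C}.Finite := by
  by_contra hinf
  obtain ⟨s, hs, hcard⟩ := Set.Infinite.exists_subset_card_eq hinf 3
  have hmem := fun i => hs (s.orderEmbOfFin_mem hcard i)
  have hlt := (s.orderEmbOfFin hcard).strictMono
  exact not_three_mem_frontier_of_null hC hnull (hlt (show (0 : Fin 3) < 1 by decide))
    (hlt (show (1 : Fin 3) < 2 by decide)) (hmem 0) (hmem 1) (hmem 2)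

end ConvexLine

section Parallelogram

/-- The signed area of the parallelogram spanned by two vectors of the plane. -/
def cross (x y : Plane) : ℝ := x 0 * y 1 - x 1 * y 0

lemma cross_sq (x y : Plane) : cross x y ^ 2 = ‖x‖ ^ 2 * ‖y‖ ^ 2 - inner ℝ x y ^ 2 := by
  rw [EuclideanSpace.real_norm_sq_eq, EuclideanSpace.real_norm_sq_eq, PiLp.inner_apply]
  simp only [Fin.sum_univ_two, cross, RCLike.inner_apply, conj_trivial]
  ring

lemma abs_cross_map (R : Plane ≃ₗᵢ[ℝ] Plane) (x y : Plane) :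
    |cross (R x) (R y)| = |cross x y| := by
  rw [← sq_eq_sq_iff_abs_eq_abs, cross_sq, cross_sq, R.norm_map, R.norm_map, R.inner_map_map]

lemma neg_cross (x y : Plane) : -cross x y = cross y x := by
  simp only [cross]
  ring

lemma cross_smul_right (t : ℝ) (x y : Plane) : cross x (t • y) = t * cross x y := by
  simp only [cross, PiLp.smul_apply, smul_eq_mul]
  ring

/-- The linear map of the plane that takes the standard basis to `g`, `d`. -/
def frame (g d : Plane) : Plane →ₗ[ℝ] Plane := Matrix.toLpLin 2 2 !![g 0, d 0; g 1, d 1]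

lemma frame_apply (g d v : Plane) : frame g d v = v 0 • g + v 1 • d := by
  ext i
  fin_cases i <;>
  simp [frame, Matrix.toLpLin_apply, dotProduct, Fin.sum_univ_two] <;>
  ring

lemma det_frame (g d : Plane) : LinearMap.det (frame g d) = cross g d := by
  rw [frame, Matrix.toLpLin_eq_toLin, LinearMap.det_toLin, Matrix.det_fin_two_of, cross]
  ring

lemma measurePreserving_pair :
    MeasurePreserving (fun z : ℝ × ℝ => (!₂[z.1, z.2] : Plane)) :=
  (PiLp.volume_preserving_toLp (Fin 2)).comp (volume_preserving_finTwoArrow ℝ).symm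

/-- The affine parametrization `(s, t) ↦ a + s g + t d` of the plane; it takes the unit square to
the parallelogram spanned by `g` and `d` at `a`. -/
def param (a g d : Plane) (z : ℝ × ℝ) : Plane := a + z.1 • g + z.2 • d

lemma continuous_param (a g d : Plane) : Continuous (param a g d) := by
  unfold param
  fun_prop

lemma map_param (a : Plane) {g d : Plane} (hgd : cross g d ≠ 0) :
    Measure.map (param a g d) volume = ENNReal.ofReal |(cross g d)⁻¹| • volume := by
  have hcomp : param a g d =
      (fun x : Plane => a + x) ∘ frame g d ∘ fun z : ℝ × ℝ => (!₂[z.1, z.2] : Plane) := by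
    funext z
    simp [param, frame_apply, add_assoc]
  have hframe : Measurable (frame g d) := (LinearMap.continuous_of_finiteDimensional _).measurable
  rw [hcomp, ← Measure.map_map (measurable_const_add a)
      (hframe.comp measurePreserving_pair.measurable),
    ← Measure.map_map hframe measurePreserving_pair.measurable, measurePreserving_pair.map_eq,
    Measure.map_linearMap_addHaar_eq_smul_addHaar _ (by rwa [det_frame]), Measure.map_smul,
    map_add_left_eq_self, det_frame]

lemma ae_param (a : Plane) {g d : Plane} (hgd : cross g d ≠ 0) {P : Plane → Prop}
    (hP : ∀ᵐ x, P x) : ∀ᵐ z, P (param a g d z) := by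
  refine ae_of_ae_map (continuous_param a g d).aemeasurable ?_
  rw [map_param a hgd]
  exact Measure.ae_smul_measure hP _

lemma integrableOn_comp_param_and_integral_le (a : Plane) {g d : Plane} (hgd : cross g d ≠ 0)
    {Q : Set (ℝ × ℝ)} {K : Set Plane} (hK : MeasurableSet K) (hQ : MapsTo (param a g d) Q K)
    {f : Plane → ℝ} (hfm : Measurable f) (hf : IntegrableOn f K) (hf0 : ∀ x, 0 ≤ f x) :
    IntegrableOn (fun z => f (param a g d z)) Q ∧
      ∫ z in Q, f (param a g d z) ≤ |(cross g d)⁻¹| * ∫ x in K, f x := by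
  have hpm := (continuous_param a g d).measurable
  have hmap : IntegrableOn f K (Measure.map (param a g d) volume) := by
    rw [map_param a hgd, IntegrableOn, Measure.restrict_smul]
    exact hf.smul_measure ENNReal.ofReal_ne_top
  have hpre : IntegrableOn (fun z => f (param a g d z)) (param a g d ⁻¹' K) := by
    rw [IntegrableOn, Measure.restrict_map hpm hK] at hmap
    exact (integrable_map_measure hfm.aestronglyMeasurable hpm.aemeasurable).mp hmap
  refine ⟨hpre.mono_set hQ, ?_⟩
  calc ∫ z in Q, f (param a g d z) ≤ ∫ z in param a g d ⁻¹' K, f (param a g d z) :=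
        setIntegral_mono_set hpre (.of_forall fun _ => hf0 _) (.of_forall hQ)
    _ = |(cross g d)⁻¹| * ∫ x in K, f x := by
        rw [← setIntegral_map hK hfm.aestronglyMeasurable hpm.aemeasurable, map_param a hgd,
          Measure.restrict_smul, integral_smul_measure, ENNReal.toReal_ofReal (abs_nonneg _),
          smul_eq_mul]

/-- The triangle with vertices `(0, 0)`, `(1, 0)`, `(0, 1)`, to which areas of triangles are reduced
by affine maps. -/
def standardTriangle : Set Plane := {v | 0 ≤ v 0 ∧ 0 ≤ v 1 ∧ v 0 + v 1 ≤ 1}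

lemma volume_standardTriangle : volume standardTriangle = ENNReal.ofReal (1 / 2) := by
  have hmeas : MeasurableSet standardTriangle := by
    unfold standardTriangle
    measurability
  have hslice : ∀ s : ℝ, volume {t : ℝ | 0 ≤ s ∧ 0 ≤ t ∧ s + t ≤ 1} =
      (Icc 0 1).indicator (fun s => ENNReal.ofReal (1 - s)) s := fun s => by
    by_cases hs : s ∈ Icc (0 : ℝ) 1
    · have : {t : ℝ | 0 ≤ s ∧ 0 ≤ t ∧ s + t ≤ 1} = Icc 0 (1 - s) := by
        ext t
        simp only [mem_ofPred_eq, mem_Icc]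
        grind
      rw [this, Real.volume_Icc, indicator_of_mem hs, sub_zero]
    · have : {t : ℝ | 0 ≤ s ∧ 0 ≤ t ∧ s + t ≤ 1} = ∅ := by
        ext t
        simp only [mem_ofPred_eq, mem_empty_iff_false]
        grind
      rw [this, measure_empty, indicator_of_notMem hs]
  rw [← measurePreserving_pair.measure_preimage hmeas.nullMeasurableSet, Measure.volume_eq_prod,
    Measure.prod_apply (measurePreserving_pair.measurable hmeas)]
  simp only [standardTriangle, preimage_ofPred_eq, Matrix.cons_val_zero, Matrix.cons_val_one,
    hslice]
  rw [lintegral_indicator measurableSet_Icc, ← ofReal_integral_eq_lintegral_ofReal,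
    integral_Icc_eq_integral_Ioc, ← intervalIntegral.integral_of_le zero_le_one]
  · rw [intervalIntegral.integral_sub (by simp) (by simp)]
    norm_num
  · exact (by fun_prop : Continuous fun s : ℝ => 1 - s).integrableOn_Icc
  · exact (ae_restrict_iff' measurableSet_Icc).mpr (.of_forall fun _ hs => sub_nonneg.mpr hs.2)

lemma convexHull_eq_add_frame_image (a b c : Plane) : convexHull ℝ {a, b, c} =
    (fun x => c + x) '' (frame (a - c) (b - c) '' standardTriangle) := by
  refine Subset.antisymm (convexHull_min ?_ ?_) ?_
  · rintro x (rfl | rfl | rfl)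
    · exact ⟨_, ⟨!₂[1, 0], by simp [standardTriangle], rfl⟩, by simp [frame_apply]⟩
    · exact ⟨_, ⟨!₂[0, 1], by simp [standardTriangle], rfl⟩, by simp [frame_apply]⟩
    · exact ⟨_, ⟨!₂[0, 0], by simp [standardTriangle], rfl⟩, by simp [frame_apply]⟩
  · have hconv : Convex ℝ standardTriangle := fun x hx y hy m n hm hn hmn => by
      simp only [standardTriangle, mem_ofPred_eq, PiLp.add_apply, PiLp.smul_apply, smul_eq_mul]
        at hx hy ⊢
      exact ⟨by nlinarith, by nlinarith, by nlinarith⟩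
    exact (hconv.linear_image (frame (a - c) (b - c))).translate c
  · rintro _ ⟨_, ⟨v, ⟨h0, h1, hsum⟩, rfl⟩, rfl⟩
    have hmem := (convex_convexHull ℝ {a, b, c}).sum_mem (t := Finset.univ)
      (w := ![v 0, v 1, 1 - v 0 - v 1]) (z := ![a, b, c])
      (by
        intro i _
        fin_cases i
        exacts [h0, h1, by simp; linarith])
      (by simp [Fin.sum_univ_three])
      (by
        intro i _
        fin_cases i <;> exact subset_convexHull ℝ _ (by simp))
    convert hmem using 1
    simp only [frame_apply, Fin.sum_univ_three, Matrix.cons_val]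
    module

lemma area_eq_abs_cross_div_two (a b c : Plane) : area a b c = |cross (a - c) (b - c)| / 2 := by
  rw [area, convexHull_eq_add_frame_image, measureReal_def, image_add_left, measure_preimage_add,
    Measure.addHaar_image_linearMap, det_frame, volume_standardTriangle, ENNReal.toReal_mul,
    ENNReal.toReal_ofReal (abs_nonneg _), ENNReal.toReal_ofReal (by norm_num)]
  ring

end Parallelogram

section LipschitzDomain

/-- In the coordinates given by the isometry `R`, the part of `Ω` in `s` lies strictly above the
graph of `γ`. -/
def IsSupergraphOn (Ω s : Set Plane) (R : Plane ≃ₗᵢ[ℝ] Plane) (γ : ℝ → ℝ) : Prop :=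
  ∀ y ∈ s, y ∈ Ω ↔ γ (R y 0) < R y 1

/-- A bounded open set with Lipschitz boundary. -/
structure IsLipschitzOpen (Ω : Set Plane) : Prop where
  isOpen : IsOpen Ω
  isBounded : Bornology.IsBounded Ω
  lipschitz : ∀ x ∈ frontier Ω, ∃ (R : Plane ≃ₗᵢ[ℝ] Plane) (r : ℝ) (γ : ℝ → ℝ) (K : NNReal),
    0 < r ∧ LipschitzWith K γ ∧ IsSupergraphOn Ω (Metric.ball x r) R γ

lemma IsPolygonalLipschitzDomain.isLipschitzOpen {Ω : Set Plane}
    (hΩ : IsPolygonalLipschitzDomain Ω) : IsLipschitzOpen Ω :=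
  ⟨hΩ.isOpen, hΩ.isBounded, hΩ.lipschitz⟩

variable {Ω s : Set Plane} {R : Plane ≃ₗᵢ[ℝ] Plane} {γ : ℝ → ℝ} {x y : Plane} {ρ κ r : ℝ}

lemma IsSupergraphOn.le_of_mem_closure (hR : IsSupergraphOn Ω s R γ) (hs : IsOpen s)
    (hγ : Continuous γ) (hy : y ∈ closure Ω) (hys : y ∈ s) : γ (R y 0) ≤ R y 1 := by
  by_contra! hlt
  have hopen : IsOpen {z : Plane | R z 1 < γ (R z 0)} := isOpen_lt (by fun_prop) (by fun_prop)
  obtain ⟨z, ⟨hzlt, hzs⟩, hzΩ⟩ := mem_closure_iff.mp hy _ (hopen.inter hs) ⟨hlt, hys⟩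
  exact lt_asymm hzlt ((hR z hzs).mp hzΩ)

lemma IsSupergraphOn.add_smul_mem {v : Plane} {t : ℝ} {K : NNReal}
    (hR : IsSupergraphOn Ω s R γ) (hs : IsOpen s) (hγ : LipschitzWith K γ) (hy : y ∈ closure Ω)
    (hys : y ∈ s) (ht : 0 < t) (hv : K * |v 0| < v 1) (hyt : y + t • R.symm v ∈ s) :
    y + t • R.symm v ∈ Ω := by
  rw [hR _ hyt]
  have hle := hR.le_of_mem_closure hs hγ.continuous hy hys
  have hlip := hγ.dist_le_mul (R y 0 + t * v 0) (R y 0)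
  rw [dist_eq, dist_eq, add_sub_cancel_left, abs_mul, abs_of_pos ht] at hlip
  have habs := le_abs_self (γ (R y 0 + t * v 0) - γ (R y 0))
  simp only [map_add, map_smul, LinearIsometryEquiv.apply_symm_apply, PiLp.add_apply,
    PiLp.smul_apply, smul_eq_mul]
  nlinarith

lemma IsLipschitzOpen.interior_closure (hΩ : IsLipschitzOpen Ω) :
    interior (closure Ω) = Ω := by
  refine Subset.antisymm (fun x hx => ?_) (hΩ.isOpen.subset_interior_closure)
  by_contra hxΩ
  obtain ⟨R, r, γ, K, hr, hγ, hR⟩ :=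
    hΩ.lipschitz x ⟨interior_subset hx, by rwa [hΩ.isOpen.interior_eq]⟩
  have hcont : Filter.Tendsto (fun t : ℝ => x - t • R.symm !₂[0, 1]) (𝓝[>] 0) (𝓝 x) := by
    refine Filter.Tendsto.mono_left ?_ nhdsWithin_le_nhds
    simpa using (by fun_prop : Continuous fun t : ℝ => x - t • R.symm !₂[0, 1]).tendsto 0
  obtain ⟨t, ht, htcl, htball⟩ := ((eventually_mem_nhdsWithin (s := Ioi (0 : ℝ))).and
    ((hcont.eventually_mem (mem_interior_iff_mem_nhds.mp hx)).and
      (hcont.eventually_mem (Metric.ball_mem_nhds x hr)))).exists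
  have hle := hR.le_of_mem_closure Metric.isOpen_ball hγ.continuous htcl htball
  simp only [map_sub, map_smul, LinearIsometryEquiv.apply_symm_apply, PiLp.sub_apply,
    PiLp.smul_apply, Matrix.cons_val_zero, Matrix.cons_val_one, smul_eq_mul, mul_zero, mul_one,
    sub_zero] at hle
  exact hxΩ ((hR x (Metric.mem_ball_self hr)).mpr (by linarith [mem_Ioi.mp ht]))

lemma norm_le_one_of_sq_add_sq {v : Plane} (hv : v 0 ^ 2 + v 1 ^ 2 ≤ 1) : ‖v‖ ≤ 1 := by
  have : ‖v‖ ^ 2 ≤ 1 := by rwa [EuclideanSpace.real_norm_sq_eq, Fin.sum_univ_two]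
  nlinarith [norm_nonneg v]

/-- Of the two directions `(0, 1)` and `(1, K + 1) / (K + 2)` above the graph of a `K`-Lipschitz
function, at least one is transversal to `u`. -/
lemma exists_lt_cross (K : NNReal) {u : Plane} (hu : ‖u‖ = 1) :
    ∃ v : Plane, ‖v‖ ≤ 1 ∧ K * |v 0| < v 1 ∧ 1 / (2 * ((K : ℝ) + 2)) ≤ |cross u v| := by
  have hu_sq : |u 0| ^ 2 + |u 1| ^ 2 = 1 := by
    rw [sq_abs, sq_abs, ← Fin.sum_univ_two (fun i => u i ^ 2), ← EuclideanSpace.real_norm_sq_eq,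
      hu, one_pow]
  have hu_abs : 1 ≤ |u 0| + |u 1| := by nlinarith [abs_nonneg (u 0), abs_nonneg (u 1)]
  by_cases hlarge : 1 / (2 * ((K : ℝ) + 2)) ≤ |u 0|
  · exact ⟨!₂[0, 1], norm_le_one_of_sq_add_sq (by simp), by simp, by simpa [cross] using hlarge⟩
  · rw [not_le, lt_div_iff₀ (by positivity)] at hlarge
    refine ⟨!₂[1 / ((K : ℝ) + 2), (K + 1) / ((K : ℝ) + 2)], norm_le_one_of_sq_add_sq ?_, ?_, ?_⟩ <;>
      simp only [cross, Matrix.cons_val_zero, Matrix.cons_val_one]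
    · rw [div_pow, div_pow, ← add_div, div_le_one (by positivity)]
      nlinarith
    · rw [abs_of_pos (by positivity), mul_one_div]
      gcongr
      linarith
    · have hlower : |u 1| - |u 0| * (K + 1) ≤ |u 0 * (K + 1) - u 1| := by
        have := abs_sub_abs_le_abs_sub (u 1) (u 0 * (K + 1))
        rwa [abs_mul, abs_of_pos (by positivity : (0 : ℝ) < K + 1), abs_sub_comm] at this
      rw [mul_div_assoc', mul_one_div, ← sub_div, abs_div,
        abs_of_pos (by positivity : (0 : ℝ) < K + 2),
        div_le_div_iff₀ (by positivity) (by positivity)]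
      nlinarith

/-- A uniform interior cone condition: around each point of `s` there is, for any given direction
`g`, a direction `d` transversal to `g` which leads from the closure of `Ω` into `Ω`. -/
def HasTransversalCone (Ω s : Set Plane) (ρ κ : ℝ) : Prop :=
  ∀ x ∈ s, ∀ g : Plane, ‖g‖ = 1 → ∃ d : Plane, ‖d‖ ≤ 1 ∧ κ ≤ |cross g d| ∧
    ∀ y ∈ closure Ω, dist y x < ρ → ∀ t : ℝ, 0 < t → t < ρ → y + t • d ∈ Ω

lemma HasTransversalCone.mono {s' : Set Plane} {ρ' κ' : ℝ} (hs : HasTransversalCone Ω s ρ κ)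
    (hss' : s' ⊆ s) (hρ : ρ' ≤ ρ) (hκ : κ' ≤ κ) : HasTransversalCone Ω s' ρ' κ' := by
  intro x hx g hg
  obtain ⟨d, hd, hcross, hmem⟩ := hs x (hss' hx) g hg
  exact ⟨d, hd, hκ.trans hcross, fun y hy hyx t ht htρ =>
    hmem y hy (hyx.trans_le hρ) t ht (htρ.trans_le hρ)⟩

lemma HasTransversalCone.union {s' : Set Plane} (hs : HasTransversalCone Ω s ρ κ)
    (hs' : HasTransversalCone Ω s' ρ κ) : HasTransversalCone Ω (s ∪ s') ρ κ := by
  rintro x (hx | hx)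
  exacts [hs x hx, hs' x hx]

lemma hasTransversalCone_ball (h : ∀ g : Plane, ‖g‖ = 1 → ∃ d : Plane, ‖d‖ ≤ 1 ∧ κ ≤ |cross g d| ∧
      ∀ y ∈ closure Ω, y ∈ Metric.ball x r → ∀ t : ℝ, 0 < t → y + t • d ∈ Metric.ball x r →
        y + t • d ∈ Ω) :
    HasTransversalCone Ω (Metric.ball x (r / 3)) (r / 3) κ := by
  intro z hz g hg
  obtain ⟨d, hd, hcross, hmem⟩ := h g hg
  refine ⟨d, hd, hcross, fun y hy hyz t ht htr => hmem y hy ?_ t ht ?_⟩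
  all_goals
    rw [Metric.mem_ball] at hz ⊢
    have hyx := dist_triangle y z x
  · linarith [dist_nonneg (x := y) (y := z)]
  · have hstep : dist (y + t • d) y ≤ t := by
      rw [dist_self_add_left, norm_smul, norm_of_nonneg ht.le]
      nlinarith
    linarith [dist_triangle (y + t • d) y x]

lemma IsLipschitzOpen.exists_hasTransversalCone_ball (hΩ : IsLipschitzOpen Ω)
    (hx : x ∈ closure Ω) : ∃ ρ κ : ℝ, 0 < ρ ∧ 0 < κ ∧
      HasTransversalCone Ω (Metric.ball x ρ) ρ κ := by
  by_cases hxΩ : x ∈ Ω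
  · obtain ⟨r, hr, hrΩ⟩ := Metric.isOpen_iff.mp hΩ.isOpen x hxΩ
    refine ⟨r / 3, 1, by positivity, one_pos, hasTransversalCone_ball fun g hg => ?_⟩
    have hg_sq : g 0 ^ 2 + g 1 ^ 2 = 1 := by
      rw [← Fin.sum_univ_two (fun i => g i ^ 2), ← EuclideanSpace.real_norm_sq_eq, hg, one_pow]
    refine ⟨!₂[-g 1, g 0], norm_le_one_of_sq_add_sq ?_, ?_, fun _ _ _ _ _ hyt => hrΩ hyt⟩ <;>
      simp only [cross, Matrix.cons_val_zero, Matrix.cons_val_one]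
    · linarith
    · rw [show g 0 * g 0 - g 1 * -g 1 = 1 by linarith, abs_one]
  · obtain ⟨R, r, γ, K, hr, hγ, hR⟩ := hΩ.lipschitz x ⟨hx, by rwa [hΩ.isOpen.interior_eq]⟩
    refine ⟨r / 3, 1 / (2 * ((K : ℝ) + 2)), by positivity, by positivity,
      hasTransversalCone_ball fun g hg => ?_⟩
    obtain ⟨v, hv, hvK, hcross⟩ := exists_lt_cross K (u := R g) (by simpa using hg)
    refine ⟨R.symm v, by simpa using hv, ?_, fun y hy hyx t ht hyt =>
      hR.add_smul_mem Metric.isOpen_ball hγ hy hyx ht hvK hyt⟩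
    rwa [← abs_cross_map R, R.apply_symm_apply]

lemma IsLipschitzOpen.exists_hasTransversalCone (hΩ : IsLipschitzOpen Ω) :
    ∃ ρ κ : ℝ, 0 < ρ ∧ 0 < κ ∧ HasTransversalCone Ω (closure Ω) ρ κ := by
  refine hΩ.isBounded.isCompact_closure.induction_on
    (p := fun s => ∃ ρ κ : ℝ, 0 < ρ ∧ 0 < κ ∧ HasTransversalCone Ω s ρ κ) ?_ ?_ ?_ ?_
  · exact ⟨1, 1, one_pos, one_pos, fun x hx => absurd hx (notMem_empty x)⟩
  · rintro s t hst ⟨ρ, κ, hρ, hκ, H⟩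
    exact ⟨ρ, κ, hρ, hκ, H.mono hst le_rfl le_rfl⟩
  · rintro s s' ⟨ρ, κ, hρ, hκ, H⟩ ⟨ρ', κ', hρ', hκ', H'⟩
    exact ⟨min ρ ρ', min κ κ', lt_min hρ hρ', lt_min hκ hκ',
      (H.mono subset_rfl (min_le_left _ _) (min_le_left _ _)).union
        (H'.mono subset_rfl (min_le_right _ _) (min_le_right _ _))⟩
  · intro x hx
    obtain ⟨ρ, κ, hρ, hκ, H⟩ := hΩ.exists_hasTransversalCone_ball hx
    exact ⟨Metric.ball x ρ, mem_nhdsWithin_of_mem_nhds (Metric.ball_mem_nhds x hρ), ρ, κ, hρ, hκ, H⟩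

end LipschitzDomain

section Triangulations

variable {𝒯 : Complex2} {Ω T T' : Set Plane} {h : ℝ}

lemma convexHull_subset_space (hT : T ∈ elements 𝒯) : convexHull ℝ T ⊆ 𝒯.space := by
  obtain ⟨s, hs, -, rfl⟩ := hT
  exact Geometry.SimplicialComplex.convexHull_subset_space hs

lemma isCompact_convexHull_of_mem_elements (hT : T ∈ elements 𝒯) : IsCompact (convexHull ℝ T) := by
  obtain ⟨s, -, -, rfl⟩ := hT
  exact s.finite_toSet.isCompact_convexHull ℝ

lemma notMem_affineSpan_of_mem_elements (hT : T ∈ elements 𝒯) {x : Plane} (hx : x ∈ T) :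
    x ∉ affineSpan ℝ (T \ {x}) := by
  obtain ⟨s, hs, -, rfl⟩ := hT
  have hnot := (𝒯.indep hs).notMem_affineSpan_sdiff ⟨x, hx⟩ univ
  rwa [image_sdiff Subtype.val_injective, image_univ, image_singleton, Subtype.range_coe] at hnot

lemma aedisjoint_convexHull (hT : T ∈ elements 𝒯) (hT' : T' ∈ elements 𝒯) (hne : T ≠ T') :
    AEDisjoint volume (convexHull ℝ T) (convexHull ℝ T') := by
  obtain ⟨x, hxT, hxT'⟩ : ∃ x ∈ T, x ∉ T' := by
    by_contra! hsub
    obtain ⟨s, -, hs, rfl⟩ := hT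
    obtain ⟨t, -, ht, rfl⟩ := hT'
    exact hne (congrArg _ (Finset.eq_of_subset_of_card_le hsub (by rw [hs, ht])))
  have hsub : convexHull ℝ T ∩ convexHull ℝ T' ⊆ affineSpan ℝ (T \ {x}) := by
    obtain ⟨s, hs, -, rfl⟩ := hT
    obtain ⟨t, ht, -, rfl⟩ := hT'
    refine (𝒯.inter_subset_convexHull hs ht).trans ((convexHull_mono ?_).trans
      (convexHull_subset_affineSpan _))
    exact fun y hy => ⟨hy.1, fun hyx => hxT' (hyx ▸ hy.2)⟩
  refine measure_mono_null hsub (Measure.addHaar_affineSubspace _ _ fun htop =>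
    notMem_affineSpan_of_mem_elements hT hxT ?_)
  rw [htop]
  exact AffineSubspace.mem_top ℝ _ x

namespace IsTriangulation

variable (h𝒯 : IsTriangulation Ω 𝒯 h)
include h𝒯

lemma finite_elements : (elements 𝒯).Finite := by
  refine (h𝒯.finite.image (fun s : Finset Plane => (s : Set Plane))).subset ?_
  rintro T ⟨s, hs, -, rfl⟩
  exact ⟨s, hs, rfl⟩

lemma closure_eq : closure Ω = ⋃ T ∈ elements 𝒯, convexHull ℝ T := by
  rw [← h𝒯.space_eq]
  refine Subset.antisymm (fun x hx => ?_) (iUnion₂_subset fun T => convexHull_subset_space)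
  obtain ⟨s, hs, hxs⟩ := Geometry.SimplicialComplex.mem_space_iff.mp hx
  obtain ⟨t, ht, hst, hcard⟩ := h𝒯.pure s hs
  exact mem_biUnion ⟨t, ht, hcard, rfl⟩ (convexHull_mono (Finset.coe_subset.mpr hst) hxs)

lemma convexHull_subset_closure (hT : T ∈ elements 𝒯) : convexHull ℝ T ⊆ closure Ω :=
  h𝒯.space_eq ▸ convexHull_subset_space hT

lemma exists_mem_interior {x : Plane} (hx : x ∈ closure Ω)
    (hfr : ∀ T ∈ elements 𝒯, x ∉ frontier (convexHull ℝ T)) :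
    ∃ T ∈ elements 𝒯, x ∈ interior (convexHull ℝ T) := by
  rw [h𝒯.closure_eq] at hx
  obtain ⟨T, hT, hxT⟩ := mem_iUnion₂.mp hx
  exact ⟨T, hT, by_contra fun hint => hfr T hT ⟨subset_closure hxT, hint⟩⟩

lemma ae_exists_mem_interior :
    ∀ᵐ x, x ∈ closure Ω → ∃ T ∈ elements 𝒯, x ∈ interior (convexHull ℝ T) := by
  have hfr : ∀ᵐ x, ∀ T ∈ elements 𝒯, x ∉ frontier (convexHull ℝ T) :=
    (ae_ball_iff h𝒯.finite_elements.countable).mpr fun T _ =>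
      measure_eq_zero_iff_ae_notMem.mp ((convex_convexHull ℝ T).addHaar_frontier volume)
  filter_upwards [hfr] with x hx hxΩ
  exact h𝒯.exists_mem_interior hxΩ hx

lemma ae_eq_closure (hΩ : IsLipschitzOpen Ω) : Ω =ᵐ[volume] closure Ω := by
  refine subset_closure.eventuallyLE.antisymm ?_
  filter_upwards [h𝒯.ae_exists_mem_interior] with x hx hxΩ
  obtain ⟨T, hT, hxT⟩ := hx hxΩ
  rw [← hΩ.interior_closure]
  exact interior_mono (h𝒯.convexHull_subset_closure hT) hxT

lemma sum_setIntegral_le {ι : Type*} [Fintype ι] {T : ι → Set Plane}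
    (hT : ∀ i, T i ∈ elements 𝒯) (hinj : Function.Injective T) {f : Plane → ℝ}
    (hf : IntegrableOn f (closure Ω)) (hf0 : ∀ x, 0 ≤ f x) :
    ∑ i, ∫ x in convexHull ℝ (T i), f x ≤ ∫ x in closure Ω, f x := by
  have hsub : ⋃ i, convexHull ℝ (T i) ⊆ closure Ω :=
    iUnion_subset fun i => h𝒯.convexHull_subset_closure (hT i)
  rw [← tsum_fintype (L := .unconditional _), ← integral_iUnion_ae
    (fun i => (isCompact_convexHull_of_mem_elements (hT i)).measurableSet.nullMeasurableSet)
    (fun i j hij => aedisjoint_convexHull (hT i) (hT j) (hinj.ne hij)) (hf.mono_set hsub)]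
  exact setIntegral_mono_set hf (Filter.Eventually.of_forall hf0) hsub.eventuallyLE

end IsTriangulation

end Triangulations

section PiecewiseDifferentiable

/-- A continuous function on a triangulated set whose restrictions to the open triangles are
differentiable with uniformly bounded derivatives. -/
structure PiecewiseDifferentiable (𝒯 : Complex2) (v : Plane → ℝ) : Prop where
  continuousOn : ContinuousOn v 𝒯.space
  differentiableAt : ∀ T ∈ elements 𝒯, ∀ x ∈ interior (convexHull ℝ T), DifferentiableAt ℝ v x
  exists_norm_fderiv_le : ∃ b, ∀ T ∈ elements 𝒯, ∀ x ∈ interior (convexHull ℝ T),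
    ‖fderiv ℝ v x‖ ≤ b

lemma PiecewiseDifferentiable.integrableOn_sq_norm_fderiv {𝒯 : Complex2} {Ω : Set Plane} {h : ℝ}
    {v : Plane → ℝ} (hv : PiecewiseDifferentiable 𝒯 v) (h𝒯 : IsTriangulation Ω 𝒯 h)
    (hΩ : Bornology.IsBounded Ω) : IntegrableOn (fun x => ‖fderiv ℝ v x‖ ^ 2) (closure Ω) := by
  obtain ⟨b, hb⟩ := hv.exists_norm_fderiv_le
  refine IntegrableOn.of_bound hΩ.closure.measure_lt_top
    ((measurable_fderiv ℝ v).norm.pow_const 2).aestronglyMeasurable (b ^ 2) ?_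
  rw [ae_restrict_iff' isClosed_closure.measurableSet]
  filter_upwards [h𝒯.ae_exists_mem_interior] with x hx hxΩ
  obtain ⟨T, hT, hxT⟩ := hx hxΩ
  rw [norm_of_nonneg (by positivity)]
  gcongr
  exact hb T hT x hxT

end PiecewiseDifferentiable

section InterpolationError

variable {𝒯 : Complex2} {Ω T : Set Plane} {h : ℝ} {U : Plane → ℝ} {w x : Plane}

/-- `w` is the gradient of `U` on the closed triangle with vertex set `T`. -/
def IsGradOn (U : Plane → ℝ) (T : Set Plane) (w : Plane) : Prop :=
  ∀ x ∈ convexHull ℝ T, ∀ y ∈ convexHull ℝ T, U x - U y = inner ℝ w (x - y)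

lemma exists_isGradOn (hU : U ∈ feSpace 𝒯) (hT : T ∈ elements 𝒯) : ∃ w, IsGradOn U T w := by
  obtain ⟨A, hA⟩ := hU.2 T hT
  refine ⟨(InnerProductSpace.toDual ℝ Plane).symm A.linear.toContinuousLinearMap,
    fun x hx y hy => ?_⟩
  rw [InnerProductSpace.toDual_symm_apply, hA hx, hA hy]
  simpa using (A.linearMap_vsub x y).symm

/-- The error `u - U` of an approximation `U` of the quadratic `u`. -/
def err (U : Plane → ℝ) (x : Plane) : ℝ := quadFun x - U x

lemma quadFun_eq (x : Plane) : quadFun x = ‖x‖ ^ 2 := by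
  rw [EuclideanSpace.real_norm_sq_eq, Fin.sum_univ_two, quadFun]

lemma IsGradOn.hasFDerivAt_err (hw : IsGradOn U T w) (hx : x ∈ interior (convexHull ℝ T)) :
    HasFDerivAt (err U) (innerSL ℝ ((2 : ℝ) • x - w)) x := by
  have hlin : HasFDerivAt (fun y => innerSL ℝ w (y - x)) (innerSL ℝ w) x :=
    (innerSL ℝ w).hasFDerivAt.comp x ((hasFDerivAt_id x).sub_const x)
  have hdiff := (hasStrictFDerivAt_norm_sq x).hasFDerivAt.sub (hlin.const_add (U x))
  rw [show 2 • innerSL ℝ x - innerSL ℝ w = innerSL ℝ ((2 : ℝ) • x - w) by ext; simp] at hdiff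
  refine hdiff.congr_of_eventuallyEq ?_
  filter_upwards [isOpen_interior.mem_nhds hx] with y hy
  have hUy := hw y (interior_subset hy) x (interior_subset hx)
  simp only [err, quadFun_eq, innerSL_apply_apply, Pi.sub_apply, ← hUy, add_sub_cancel]

lemma IsGradOn.norm_fderiv_err (hw : IsGradOn U T w) (hx : x ∈ interior (convexHull ℝ T)) :
    ‖fderiv ℝ (err U) x‖ = ‖(2 : ℝ) • x - w‖ := by
  rw [(hw.hasFDerivAt_err hx).fderiv, innerSL_apply_norm]

lemma IsTriangulation.piecewiseDifferentiable_err (h𝒯 : IsTriangulation Ω 𝒯 h)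
    (hU : U ∈ feSpace 𝒯) : PiecewiseDifferentiable 𝒯 (err U) where
  continuousOn := by
    refine ContinuousOn.sub (Continuous.continuousOn ?_) hU.1
    simp only [funext quadFun_eq]
    fun_prop
  differentiableAt T hT x hx :=
    ((exists_isGradOn hU hT).choose_spec.hasFDerivAt_err hx).differentiableAt
  exists_norm_fderiv_le := by
    have hlocal : ∀ T ∈ elements 𝒯, ∃ b, ∀ x ∈ interior (convexHull ℝ T),
        ‖fderiv ℝ (err U) x‖ ≤ b := by
      intro T hT
      obtain ⟨w, hw⟩ := exists_isGradOn hU hT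
      obtain ⟨R, hR⟩ := (isCompact_convexHull_of_mem_elements hT).isBounded.exists_norm_le
      refine ⟨2 * R + ‖w‖, fun x hx => ?_⟩
      calc ‖fderiv ℝ (err U) x‖ = ‖(2 : ℝ) • x - w‖ := hw.norm_fderiv_err hx
        _ ≤ 2 * ‖x‖ + ‖w‖ := by simpa [norm_smul] using norm_sub_le ((2 : ℝ) • x) w
        _ ≤ 2 * R + ‖w‖ := by gcongr; exact hR x (interior_subset hx)
    choose! b hb using hlocal
    obtain ⟨c, hc⟩ := (h𝒯.finite_elements.image b).bddAbove
    exact ⟨c, fun T hT x hx => (hb T hT x hx).trans (hc ⟨T, hT, rfl⟩)⟩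

/-- The contribution `∫_T |∇(u - U)|²` of the triangle with vertex set `T` to the squared error. -/
def localEnergy (U : Plane → ℝ) (T : Set Plane) : ℝ :=
  ∫ x in convexHull ℝ T, ‖fderiv ℝ (err U) x‖ ^ 2

lemma IsTriangulation.sq_h1Seminorm (h𝒯 : IsTriangulation Ω 𝒯 h) (hΩ : IsLipschitzOpen Ω)
    (v : Plane → ℝ) : h1Seminorm Ω v ^ 2 = ∫ x in closure Ω, ‖fderiv ℝ v x‖ ^ 2 := by
  rw [h1Seminorm, sq_sqrt (integral_nonneg fun x => by positivity),
    setIntegral_congr_set (h𝒯.ae_eq_closure hΩ)]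

lemma IsTriangulation.sum_localEnergy_le {ι : Type*} [Fintype ι] (h𝒯 : IsTriangulation Ω 𝒯 h)
    (hΩ : IsLipschitzOpen Ω) (hU : U ∈ feSpace 𝒯) {T : ι → Set Plane}
    (hT : ∀ i, T i ∈ elements 𝒯) (hinj : Function.Injective T) :
    ∑ i, localEnergy U (T i) ≤ h1Seminorm Ω (err U) ^ 2 := by
  rw [h𝒯.sq_h1Seminorm hΩ]
  exact h𝒯.sum_setIntegral_le hT hinj
    ((h𝒯.piecewiseDifferentiable_err hU).integrableOn_sq_norm_fderiv h𝒯 hΩ.isBounded)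
    fun x => by positivity

lemma IsGradOn.measureReal_mul_sq_norm_le (hw : IsGradOn U T w) (hT : T ∈ elements 𝒯)
    {p : Plane} (hp : p ∈ convexHull ℝ T) :
    volume.real (convexHull ℝ T) * ‖w - (2 : ℝ) • p‖ ^ 2 ≤ 34 * localEnergy U T := by
  have hcompact := isCompact_convexHull_of_mem_elements hT
  let F : Plane →ᵃ[ℝ] Plane := (2 : ℝ) • AffineMap.id ℝ Plane - AffineMap.const ℝ Plane w
  have hF : ∀ x, F x = (2 : ℝ) • x - w := fun x => rfl
  have hint : IntegrableOn (fun x => ‖F x‖ ^ 2) (convexHull ℝ T) := by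
    refine ContinuousOn.integrableOn_compact hcompact (Continuous.continuousOn ?_)
    simp only [hF]
    fun_prop
  have hae : localEnergy U T = ∫ x in convexHull ℝ T, ‖F x‖ ^ 2 := by
    refine setIntegral_congr_ae hcompact.measurableSet ?_
    filter_upwards [measure_eq_zero_iff_ae_notMem.mp
      ((convex_convexHull ℝ T).addHaar_frontier volume)] with x hx hxT
    rw [hw.norm_fderiv_err (by_contra fun hint => hx ⟨subset_closure hxT, hint⟩), hF]
  have hbound := BandFEM.measureReal_mul_sq_norm_le volume (convex_convexHull ℝ T)
    hcompact.measurableSet hp F hint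
  rw [finrank_euclideanSpace_fin, hF, norm_sub_rev] at hbound
  rw [hae]
  norm_num at hbound
  exact hbound

end InterpolationError

section GreenFormula

/-- `G` is the derivative of `F` in the first variable, along almost every horizontal line through
the unit square and there up to countably many points. -/
structure HasAEFstDeriv (F G : ℝ × ℝ → ℝ) : Prop where
  continuousOn : ContinuousOn F (Icc 0 1 ×ˢ Icc 0 1)
  integrableOn : IntegrableOn G (Icc 0 1 ×ˢ Icc 0 1)
  hasDerivAt : ∀ᵐ t : ℝ, t ∈ Icc 0 1 → ∃ S : Set ℝ, S.Countable ∧ ∀ s ∈ Ioo 0 1 \ S,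
    HasDerivAt (fun s => F (s, t)) (G (s, t)) s

variable {φ φ' η : ℝ → ℝ} {F G G₁ G₂ : ℝ × ℝ → ℝ}

lemma integral_deriv_mul_add {f f' : ℝ → ℝ} {S : Set ℝ} (hS : S.Countable)
    (hf : ContinuousOn f (Icc 0 1)) (hf' : ∀ t ∈ Ioo 0 1 \ S, HasDerivAt f (f' t) t)
    (hi : IntegrableOn f' (Icc 0 1)) (hφ : ∀ t, HasDerivAt φ (φ' t) t) (hφ' : Continuous φ') :
    ∫ t in Icc 0 1, (f' t * φ t + f t * φ' t) = f 1 * φ 1 - f 0 * φ 0 := by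
  have hφc : Continuous φ := continuous_iff_continuousAt.mpr fun t => (hφ t).continuousAt
  rw [integral_Icc_eq_integral_Ioc, ← intervalIntegral.integral_of_le zero_le_one]
  refine integral_eq_of_hasDerivAt_off_countable (fun t => f t * φ t) _ hS ?_ ?_ ?_
  · rw [uIcc_of_le zero_le_one]
    exact hf.mul hφc.continuousOn
  · rw [min_eq_left zero_le_one, max_eq_right zero_le_one]
    exact fun t ht => (hf' t ht).mul (hφ t)
  · rw [intervalIntegrable_iff_integrableOn_Icc_of_le zero_le_one]
    exact (hi.mul_continuousOn hφc.continuousOn isCompact_Icc).add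
      ((hf.mul hφ'.continuousOn).integrableOn_compact isCompact_Icc)

lemma HasAEFstDeriv.integrableOn_mul_add (hF : HasAEFstDeriv F G) (hφ : Continuous φ)
    (hφ' : Continuous φ') (hη : Continuous η) :
    IntegrableOn (fun z : ℝ × ℝ => (G z * φ z.1 + F z * φ' z.1) * η z.2)
      (Icc 0 1 ×ˢ Icc 0 1) := by
  have hQ : IsCompact (Icc (0 : ℝ) 1 ×ˢ Icc (0 : ℝ) 1) := isCompact_Icc.prod isCompact_Icc
  exact ((hF.integrableOn.mul_continuousOn (hφ.comp continuous_fst).continuousOn hQ).add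
    ((hF.continuousOn.mul (hφ'.comp continuous_fst).continuousOn).integrableOn_compact
      hQ)).mul_continuousOn (hη.comp continuous_snd).continuousOn hQ

lemma HasAEFstDeriv.integral_mul_add (hF : HasAEFstDeriv F G)
    (hφ : ∀ t, HasDerivAt φ (φ' t) t) (hφ' : Continuous φ') (hη : Continuous η) :
    ∫ z in Icc 0 1 ×ˢ Icc 0 1, (G z * φ z.1 + F z * φ' z.1) * η z.2 =
      ∫ t in Icc 0 1, (F (1, t) * φ 1 - F (0, t) * φ 0) * η t := by
  have hφc : Continuous φ := continuous_iff_continuousAt.mpr fun t => (hφ t).continuousAt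
  have hi := hF.integrableOn_mul_add hφc hφ' hη
  have hG := hF.integrableOn
  rw [IntegrableOn, Measure.volume_eq_prod, ← Measure.prod_restrict] at hi hG
  rw [Measure.volume_eq_prod, ← Measure.prod_restrict, integral_prod_symm _ hi]
  refine setIntegral_congr_ae measurableSet_Icc ?_
  filter_upwards [hF.hasDerivAt, (ae_restrict_iff' measurableSet_Icc).mp hG.prod_left_ae]
    with t ht hGt htI
  obtain ⟨S, hS, hderiv⟩ := ht htI
  have hFt : ContinuousOn (fun s => F (s, t)) (Icc 0 1) :=
    hF.continuousOn.comp (by fun_prop) fun s hs => ⟨hs, htI⟩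
  rw [integral_mul_const, integral_deriv_mul_add hS hFt hderiv (hGt htI) hφ hφ']

lemma setIntegral_square_comp_swap (f : ℝ × ℝ → ℝ) :
    ∫ z in Icc 0 1 ×ˢ Icc 0 1, f z.swap = ∫ z in Icc 0 1 ×ˢ Icc 0 1, f z := by
  rw [Measure.volume_eq_prod]
  exact setIntegral_prod_swap (Icc (0 : ℝ) 1) (Icc (0 : ℝ) 1) f

lemma integral_edge_mul_deriv (h₁ : HasAEFstDeriv F G₁)
    (h₂ : HasAEFstDeriv (F ∘ Prod.swap) (G₂ ∘ Prod.swap)) (hφ : ∀ t, HasDerivAt φ (φ' t) t)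
    (hφ' : Continuous φ') (h0 : φ 0 = 0) (h1 : φ 1 = 0) :
    ∫ s in Icc 0 1, F (s, 0) * φ' s =
      -∫ z in Icc 0 1 ×ˢ Icc 0 1, (G₁ z * φ z.1 + G₂ z * (φ' z.1 * (1 - z.2))) := by
  have hφc : Continuous φ := continuous_iff_continuousAt.mpr fun t => (hφ t).continuousAt
  have hhat : ∀ t : ℝ, HasDerivAt (fun t => 1 - t) (-1) t := fun t => (hasDerivAt_id t).const_sub 1
  have hi₁ : IntegrableOn (fun z : ℝ × ℝ => G₁ z * φ z.1 + F z * φ' z.1)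
      (Icc 0 1 ×ˢ Icc 0 1) := by
    simpa using h₁.integrableOn_mul_add hφc hφ' (continuous_const (y := (1 : ℝ)))
  have hi₂ : IntegrableOn (fun z : ℝ × ℝ => (G₂ z * (1 - z.2) + F z * -1) * φ' z.1)
      (Icc 0 1 ×ˢ Icc 0 1) :=
    (h₂.integrableOn_mul_add (continuous_sub_left 1) continuous_const hφ').swap
  have heq₁ : ∫ z in Icc 0 1 ×ˢ Icc 0 1, (G₁ z * φ z.1 + F z * φ' z.1) = 0 := by
    simpa [h0, h1] using h₁.integral_mul_add hφ hφ' (continuous_const (y := (1 : ℝ)))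
  have heq₂ : ∫ z in Icc 0 1 ×ˢ Icc 0 1, (G₂ z * (1 - z.2) + F z * -1) * φ' z.1 =
      -∫ s in Icc 0 1, F (s, 0) * φ' s := by
    rw [← setIntegral_square_comp_swap, ← integral_neg]
    simpa using h₂.integral_mul_add hhat continuous_const hφ'
  have hsum := integral_add hi₁ hi₂
  rw [heq₁, zero_add, heq₂] at hsum
  rw [← neg_eq_iff_eq_neg, ← hsum]
  exact integral_congr_ae (.of_forall fun z => by ring)

end GreenFormula

section TraceEstimate

variable {𝒯 : Complex2} {Ω : Set Plane} {h : ℝ} {v : Plane → ℝ} {a g d x : Plane}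

lemma ae_finite_line_inter_frontier (h𝒯 : IsTriangulation Ω 𝒯 h) (hgd : cross g d ≠ 0) :
    ∀ᵐ t : ℝ, ∀ T ∈ elements 𝒯,
      {s : ℝ | a + t • d + s • g ∈ frontier (convexHull ℝ T)}.Finite := by
  refine (ae_ball_iff h𝒯.finite_elements.countable).mpr fun T _ => ?_
  have hfr := ae_param a (g := d) (d := g) (by rwa [← neg_cross, neg_ne_zero])
    (measure_eq_zero_iff_ae_notMem.mp ((convex_convexHull ℝ T).addHaar_frontier volume))
  filter_upwards [Measure.ae_ae_of_ae_prod hfr] with t ht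
  exact finite_line_inter_frontier_of_null (convex_convexHull ℝ T)
    (measure_eq_zero_iff_ae_notMem.mpr ht)

lemma PiecewiseDifferentiable.exists_hasDerivAt_line (hv : PiecewiseDifferentiable 𝒯 v)
    (h𝒯 : IsTriangulation Ω 𝒯 h)
    (hfin : ∀ T ∈ elements 𝒯, {s : ℝ | x + s • g ∈ frontier (convexHull ℝ T)}.Finite)
    (hmem : ∀ s ∈ Icc (0 : ℝ) 1, x + s • g ∈ closure Ω) :
    ∃ S : Set ℝ, S.Countable ∧ ∀ s ∈ Ioo 0 1 \ S,
      HasDerivAt (fun s : ℝ => v (x + s • g)) (fderiv ℝ v (x + s • g) g) s := by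
  refine ⟨⋃ T ∈ elements 𝒯, {s : ℝ | x + s • g ∈ frontier (convexHull ℝ T)},
    h𝒯.finite_elements.countable.biUnion fun T hT => (hfin T hT).countable, ?_⟩
  rintro s ⟨hs, hsS⟩
  obtain ⟨T, hT, hsT⟩ := h𝒯.exists_mem_interior (hmem s (Ioo_subset_Icc_self hs))
    fun T hT hsT => hsS (mem_biUnion hT hsT)
  have hline : HasDerivAt (fun s : ℝ => x + s • g) g s := by
    simpa using ((hasDerivAt_id s).smul_const g).const_add x
  exact (hv.differentiableAt T hT _ hsT).hasFDerivAt.comp_hasDerivAt s hline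

lemma PiecewiseDifferentiable.integrableOn_fderiv_param (hv : PiecewiseDifferentiable 𝒯 v)
    (h𝒯 : IsTriangulation Ω 𝒯 h) (hgd : cross g d ≠ 0)
    (hmem : MapsTo (param a g d) (Icc 0 1 ×ˢ Icc 0 1) (closure Ω)) :
    IntegrableOn (fun z => fderiv ℝ v (param a g d z)) (Icc 0 1 ×ˢ Icc 0 1) := by
  obtain ⟨b, hb⟩ := hv.exists_norm_fderiv_le
  have hQ : IsCompact (Icc (0 : ℝ) 1 ×ˢ Icc (0 : ℝ) 1) := isCompact_Icc.prod isCompact_Icc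
  refine IntegrableOn.of_bound hQ.measure_lt_top ((measurable_fderiv ℝ v).comp
    (continuous_param a g d).measurable).aestronglyMeasurable b ?_
  rw [ae_restrict_iff' hQ.measurableSet]
  filter_upwards [ae_param a hgd h𝒯.ae_exists_mem_interior] with z hz hzQ
  obtain ⟨T, hT, hzT⟩ := hz (hmem hzQ)
  exact hb T hT _ hzT

lemma PiecewiseDifferentiable.hasAEFstDeriv_param (hv : PiecewiseDifferentiable 𝒯 v)
    (h𝒯 : IsTriangulation Ω 𝒯 h) (hgd : cross g d ≠ 0)
    (hmem : MapsTo (param a g d) (Icc 0 1 ×ˢ Icc 0 1) (closure Ω)) :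
    HasAEFstDeriv (fun z => v (param a g d z)) (fun z => fderiv ℝ v (param a g d z) g) where
  continuousOn := (h𝒯.space_eq ▸ hv.continuousOn).comp (continuous_param a g d).continuousOn hmem
  integrableOn := (hv.integrableOn_fderiv_param h𝒯 hgd hmem).apply_continuousLinearMap g
  hasDerivAt := by
    filter_upwards [ae_finite_line_inter_frontier (a := a) h𝒯 hgd] with t ht htI
    simp only [param, add_right_comm a]
    exact hv.exists_hasDerivAt_line h𝒯 ht fun s hs => by
      rw [add_right_comm]
      exact hmem (mk_mem_prod hs htI)

lemma sq_setIntegral_square_le {f : ℝ × ℝ → ℝ} (hf : IntegrableOn f (Icc 0 1 ×ˢ Icc 0 1))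
    (hf2 : IntegrableOn (fun z => f z ^ 2) (Icc 0 1 ×ˢ Icc 0 1)) :
    (∫ z in Icc 0 1 ×ˢ Icc 0 1, f z) ^ 2 ≤ ∫ z in Icc 0 1 ×ˢ Icc 0 1, f z ^ 2 := by
  have hprob : IsProbabilityMeasure
      (volume.restrict (Icc (0 : ℝ) 1 ×ˢ Icc (0 : ℝ) 1)) :=
    ⟨by rw [Measure.restrict_apply_univ, Measure.volume_eq_prod, Measure.prod_prod]; simp⟩
  exact even_two.convexOn_pow.map_integral_le (continuous_pow 2).continuousOn isClosed_univ
    (by simp) hf hf2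

lemma norm_apply_mul_add_apply_mul_le {E : Type*} [SeminormedAddCommGroup E] [NormedSpace ℝ E]
    (L : E →L[ℝ] ℝ) (g d : E) {x y : ℝ} (hx : |x| ≤ 1) (hy : |y| ≤ 1) :
    ‖L g * x + L d * y‖ ≤ (‖g‖ + ‖d‖) * ‖L‖ := by
  calc ‖L g * x + L d * y‖ ≤ ‖L g‖ * |x| + ‖L d‖ * |y| := by
        simpa only [norm_mul, norm_eq_abs] using norm_add_le (L g * x) (L d * y)
    _ ≤ ‖L‖ * ‖g‖ * 1 + ‖L‖ * ‖d‖ * 1 := by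
        gcongr <;> exact L.le_opNorm _
    _ = (‖g‖ + ‖d‖) * ‖L‖ := by ring

section

variable {φ φ' : ℝ → ℝ} (hv : PiecewiseDifferentiable 𝒯 v) (h𝒯 : IsTriangulation Ω 𝒯 h)
  (hgd : cross g d ≠ 0) (hmem : MapsTo (param a g d) (Icc 0 1 ×ˢ Icc 0 1) (closure Ω))
  (hφ : ∀ t, HasDerivAt φ (φ' t) t) (hφ' : Continuous φ') (h0 : φ 0 = 0) (h1 : φ 1 = 0)
  (hφ_le : ∀ t ∈ Icc (0 : ℝ) 1, |φ t| ≤ 1) (hφ'_le : ∀ t ∈ Icc (0 : ℝ) 1, |φ' t| ≤ 1)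
include hv h𝒯 hgd hmem hφ hφ' h0 h1 hφ_le hφ'_le

lemma PiecewiseDifferentiable.abs_integral_edge_le :
    |∫ s in Icc 0 1, v (a + s • g) * φ' s| ≤
      (‖g‖ + ‖d‖) * ∫ z in Icc 0 1 ×ˢ Icc 0 1, ‖fderiv ℝ v (param a g d z)‖ := by
  have hswap : param a g d ∘ Prod.swap = param a d g := by
    funext z
    simp only [param, Function.comp_apply, Prod.fst_swap, Prod.snd_swap, add_right_comm a]
  have hsnd : HasAEFstDeriv ((fun z => v (param a g d z)) ∘ Prod.swap)
      ((fun z => fderiv ℝ v (param a g d z) d) ∘ Prod.swap) := by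
    have hmem' : MapsTo (param a d g) (Icc 0 1 ×ˢ Icc 0 1) (closure Ω) :=
      hswap ▸ hmem.comp fun z hz => ⟨hz.2, hz.1⟩
    have hderiv := hv.hasAEFstDeriv_param h𝒯 (by rwa [← neg_cross, neg_ne_zero]) hmem'
    rwa [← hswap] at hderiv
  have hedge := integral_edge_mul_deriv (hv.hasAEFstDeriv_param h𝒯 hgd hmem) hsnd hφ hφ' h0 h1
  simp only [param, zero_smul, add_zero] at hedge
  rw [hedge, abs_neg, ← norm_eq_abs, ← integral_const_mul]
  refine norm_integral_le_of_norm_le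
    ((hv.integrableOn_fderiv_param h𝒯 hgd hmem).norm.const_mul _)
    ((ae_restrict_iff' (measurableSet_Icc.prod measurableSet_Icc)).mpr (.of_forall fun z hz =>
      norm_apply_mul_add_apply_mul_le _ _ _ (hφ_le _ hz.1) ?_))
  rw [abs_mul, abs_of_nonneg (sub_nonneg.mpr hz.2.2)]
  exact mul_le_one₀ (hφ'_le _ hz.1) (sub_nonneg.mpr hz.2.2) (by linarith [hz.2.1])

lemma PiecewiseDifferentiable.sq_integral_edge_le (hΩ : Bornology.IsBounded Ω) :
    (∫ s in Icc 0 1, v (a + s • g) * φ' s) ^ 2 ≤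
      (‖g‖ + ‖d‖) ^ 2 * (|(cross g d)⁻¹| * ∫ x in closure Ω, ‖fderiv ℝ v x‖ ^ 2) := by
  have hint := (hv.integrableOn_fderiv_param h𝒯 hgd hmem).norm
  obtain ⟨hint_sq, hle⟩ := integrableOn_comp_param_and_integral_le a hgd
    isClosed_closure.measurableSet hmem ((measurable_fderiv ℝ v).norm.pow_const 2)
    (hv.integrableOn_sq_norm_fderiv h𝒯 hΩ) fun x => by positivity
  calc (∫ s in Icc 0 1, v (a + s • g) * φ' s) ^ 2
      ≤ ((‖g‖ + ‖d‖) * ∫ z in Icc 0 1 ×ˢ Icc 0 1, ‖fderiv ℝ v (param a g d z)‖) ^ 2 :=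
        sq_le_sq.mpr ((hv.abs_integral_edge_le h𝒯 hgd hmem hφ hφ' h0 h1 hφ_le hφ'_le).trans
          (le_abs_self _))
    _ ≤ (‖g‖ + ‖d‖) ^ 2 * ∫ z in Icc 0 1 ×ˢ Icc 0 1, ‖fderiv ℝ v (param a g d z)‖ ^ 2 := by
        rw [mul_pow]
        gcongr
        exact sq_setIntegral_square_le hint hint_sq
    _ ≤ _ := by gcongr

end

end TraceEstimate

section AlmostLinear

-- The second factor is the shifted Legendre polynomial of degree two.
lemma integral_quadratic_mul_legendre (c₀ c₁ c₂ : ℝ) :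
    ∫ s in Icc (0 : ℝ) 1, (c₀ + c₁ * s + c₂ * s ^ 2) * (1 - 6 * s + 6 * s ^ 2) = c₂ / 30 := by
  rw [integral_Icc_eq_integral_Ioc, ← intervalIntegral.integral_of_le zero_le_one,
    intervalIntegral.integral_eq_sub_of_hasDerivAt (f := fun s => c₀ * s +
      (c₁ - 6 * c₀) / 2 * s ^ 2 + (6 * c₀ - 6 * c₁ + c₂) / 3 * s ^ 3 +
      (6 * c₁ - 6 * c₂) / 4 * s ^ 4 + 6 * c₂ / 5 * s ^ 5)]
  · ring
  · intro s _
    refine (((((((hasDerivAt_id s).const_mul _).add ((hasDerivAt_pow 2 s).const_mul _)).add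
      ((hasDerivAt_pow 3 s).const_mul _)).add ((hasDerivAt_pow 4 s).const_mul _)).add
      ((hasDerivAt_pow 5 s).const_mul _))).congr_deriv ?_
    norm_num
    ring
  · exact Continuous.intervalIntegrable (by fun_prop) _ _

lemma abs_legendre_le_one {s : ℝ} (hs : s ∈ Icc (0 : ℝ) 1) : |1 - 6 * s + 6 * s ^ 2| ≤ 1 :=
  abs_le.mpr ⟨by nlinarith [sq_nonneg (1 - 2 * s)], by nlinarith [hs.1, hs.2]⟩

lemma hasDerivAt_legendrePrimitive (s : ℝ) :
    HasDerivAt (fun s : ℝ => s * (1 - s) * (1 - 2 * s)) (1 - 6 * s + 6 * s ^ 2) s := by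
  refine (((hasDerivAt_id s).mul ((hasDerivAt_id s).const_sub 1)).mul
    (((hasDerivAt_id s).const_mul 2).const_sub 1)).congr_deriv ?_
  simp only [Pi.mul_apply, id]
  ring

lemma abs_legendrePrimitive_le_one {s : ℝ} (hs : s ∈ Icc (0 : ℝ) 1) :
    |s * (1 - s) * (1 - 2 * s)| ≤ 1 := by
  obtain ⟨h0, h1⟩ := hs
  rw [abs_mul, abs_mul]
  exact mul_le_one₀ (mul_le_one₀ (abs_le.mpr ⟨by linarith, h1⟩) (abs_nonneg _)
    (abs_le.mpr ⟨by linarith, by linarith⟩)) (abs_nonneg _)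
    (abs_le.mpr ⟨by linarith, by linarith⟩)

variable {U : Plane → ℝ} {a v : Plane} {m : ℝ}

lemma le_integral_err_mul_legendre
    (hc : ContinuousOn (fun s : ℝ => err U (a + s • v)) (Icc 0 1))
    (hU : ∀ s ∈ Icc (0 : ℝ) 1, |U (a + s • v) - U a - m * s| ≤ ‖v‖ ^ 2 / 60) :
    ‖v‖ ^ 2 / 60 ≤ ∫ s in Icc (0 : ℝ) 1, err U (a + s • v) * (1 - 6 * s + 6 * s ^ 2) := by
  set c₀ := ‖a‖ ^ 2 - U a
  set c₁ := 2 * inner ℝ a v - m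
  have hquad : ∫ s in Icc (0 : ℝ) 1, ((c₀ + c₁ * s + ‖v‖ ^ 2 * s ^ 2) * (1 - 6 * s + 6 * s ^ 2) -
      ‖v‖ ^ 2 / 60) = ‖v‖ ^ 2 / 60 := by
    rw [integral_sub (Continuous.integrableOn_Icc (by fun_prop)).integrable
      (Continuous.integrableOn_Icc continuous_const).integrable,
      integral_quadratic_mul_legendre, setIntegral_const, Real.volume_real_Icc]
    norm_num
    ring
  rw [← hquad]
  refine setIntegral_mono_on (Continuous.integrableOn_Icc (by fun_prop))
    ((hc.mul (by fun_prop)).integrableOn_compact isCompact_Icc) measurableSet_Icc fun s hs => ?_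
  have herr : err U (a + s • v) =
      c₀ + c₁ * s + ‖v‖ ^ 2 * s ^ 2 - (U (a + s • v) - U a - m * s) := by
    simp only [err, quadFun_eq, c₀, c₁]
    rw [norm_add_sq_real, norm_smul, inner_smul_right, mul_pow, Real.norm_eq_abs, sq_abs]
    ring
  have hperturb : (U (a + s • v) - U a - m * s) * (1 - 6 * s + 6 * s ^ 2) ≤ ‖v‖ ^ 2 / 60 := by
    refine (le_abs_self _).trans ?_
    rw [abs_mul]
    exact (mul_le_of_le_one_right (abs_nonneg _) (abs_legendre_le_one hs)).trans (hU s hs)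
  rw [herr, sub_mul]
  linarith

variable {Ω : Set Plane} {ρ κ : ℝ}

lemma HasTransversalCone.exists_mapsTo_param (hcone : HasTransversalCone Ω (closure Ω) ρ κ)
    (hv₀ : v ≠ 0) (hvρ : ‖v‖ < ρ) (hmem : ∀ s ∈ Icc (0 : ℝ) 1, a + s • v ∈ closure Ω) :
    ∃ d : Plane, ‖d‖ ≤ ‖v‖ ∧ κ * ‖v‖ ^ 2 ≤ |cross v d| ∧
      MapsTo (param a v d) (Icc 0 1 ×ˢ Icc 0 1) (closure Ω) := by
  have hv : 0 < ‖v‖ := norm_pos_iff.mpr hv₀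
  obtain ⟨d, hd, hκd, hmove⟩ := hcone a (by simpa using hmem 0 ⟨le_rfl, zero_le_one⟩)
    (‖v‖⁻¹ • v) (norm_smul_inv_norm hv₀)
  refine ⟨‖v‖ • d, ?_, ?_, ?_⟩
  · rw [norm_smul, norm_norm]
    exact mul_le_of_le_one_right hv.le hd
  · have hcross : cross v (‖v‖ • d) = ‖v‖ ^ 2 * cross (‖v‖⁻¹ • v) d := by
      rw [cross_smul_right, ← neg_cross d (‖v‖⁻¹ • v), cross_smul_right, ← neg_cross v d]
      field_simp
    rw [hcross, abs_mul, abs_of_nonneg (sq_nonneg ‖v‖), mul_comm]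
    gcongr
  · rintro ⟨s, t⟩ ⟨hs, ht⟩
    simp only [param, smul_smul]
    rcases ht.1.eq_or_lt with rfl | ht₀
    · rw [zero_mul, zero_smul, add_zero]
      exact hmem s hs
    · refine subset_closure (hmove _ (hmem s hs) ?_ _ (mul_pos ht₀ hv)
        ((mul_le_of_le_one_left hv.le ht.2).trans_lt hvρ))
      rw [dist_eq_norm, add_sub_cancel_left, norm_smul, Real.norm_of_nonneg hs.1]
      exact (mul_le_of_le_one_left hv.le hs.2).trans_lt hvρ

lemma IsLipschitzOpen.exists_sq_norm_le_of_almost_linear (hΩ : IsLipschitzOpen Ω) :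
    ∃ ρ C : ℝ, 0 < ρ ∧ 0 < C ∧ ∀ (𝒯 : Complex2) (h : ℝ), IsTriangulation Ω 𝒯 h →
      ∀ U ∈ feSpace 𝒯, ∀ (a v : Plane) (m : ℝ), ‖v‖ < ρ →
      (∀ s ∈ Icc (0 : ℝ) 1, a + s • v ∈ closure Ω) →
      (∀ s ∈ Icc (0 : ℝ) 1, |U (a + s • v) - U a - m * s| ≤ ‖v‖ ^ 2 / 60) →
      ‖v‖ ^ 2 ≤ C * h1Seminorm Ω (err U) := by
  obtain ⟨ρ, κ, hρ, hκ, hcone⟩ := hΩ.exists_hasTransversalCone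
  refine ⟨ρ, 120 / √κ, hρ, by positivity, fun 𝒯 h h𝒯 U hU a v m hvρ hmem hlin => ?_⟩
  have hE : 0 ≤ h1Seminorm Ω (err U) := Real.sqrt_nonneg _
  rcases eq_or_ne v 0 with rfl | hv₀
  · rw [norm_zero, zero_pow two_ne_zero]
    positivity
  obtain ⟨d, hd, hκd, hmaps⟩ := hcone.exists_mapsTo_param hv₀ hvρ hmem
  have hκv : 0 < κ * ‖v‖ ^ 2 := by positivity
  have herr := h𝒯.piecewiseDifferentiable_err hU
  have hlower := le_integral_err_mul_legendre (herr.continuousOn.comp (by fun_prop)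
    fun s hs => h𝒯.space_eq ▸ hmem s hs) hlin
  have hupper := herr.sq_integral_edge_le h𝒯 (abs_pos.mp (hκv.trans_le hκd)) hmaps
    hasDerivAt_legendrePrimitive (by fun_prop) (by norm_num) (by norm_num)
    (fun s hs => abs_legendrePrimitive_le_one hs) (fun s hs => abs_legendre_le_one hs)
    hΩ.isBounded
  rw [← h𝒯.sq_h1Seminorm hΩ, abs_inv] at hupper
  have hsq : (‖v‖ ^ 2 / 60) ^ 2 ≤ (2 / √κ * h1Seminorm Ω (err U)) ^ 2 :=
    calc (‖v‖ ^ 2 / 60) ^ 2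
        ≤ (‖v‖ + ‖d‖) ^ 2 * (|cross v d|⁻¹ * h1Seminorm Ω (err U) ^ 2) :=
          (pow_le_pow_left₀ (by positivity) hlower 2).trans hupper
      _ ≤ (‖v‖ + ‖v‖) ^ 2 * ((κ * ‖v‖ ^ 2)⁻¹ * h1Seminorm Ω (err U) ^ 2) := by gcongr
      _ = (2 / √κ * h1Seminorm Ω (err U)) ^ 2 := by
          rw [mul_pow, div_pow, Real.sq_sqrt hκ.le]
          field_simp
          ring
  have hle := le_of_sq_le_sq hsq (by positivity)
  calc ‖v‖ ^ 2 = 60 * (‖v‖ ^ 2 / 60) := by ring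
    _ ≤ 60 * (2 / √κ * h1Seminorm Ω (err U)) := by gcongr
    _ = 120 / √κ * h1Seminorm Ω (err U) := by ring

end AlmostLinear

section Bands

lemma exists_mem_Icc_succ {t : ℕ → ℝ} {s : ℝ} (n : ℕ) (hs : s ∈ Icc (t 0) (t (n + 1))) :
    ∃ i ≤ n, s ∈ Icc (t i) (t (i + 1)) := by
  induction n with
  | zero => exact ⟨0, le_rfl, hs⟩
  | succ n ih =>
    rcases le_total s (t (n + 1)) with h | h
    · obtain ⟨i, hi, hsi⟩ := ih ⟨hs.1, h⟩
      exact ⟨i, hi.trans n.le_succ, hsi⟩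
    · exact ⟨n + 1, le_rfl, h, hs.2⟩

lemma abs_sub_sub_mul_le_of_slopes {f : ℝ → ℝ} {t m : ℕ → ℝ} {μ ε : ℝ} {n : ℕ} (ht : Monotone t)
    (hf : ∀ i ≤ n, ∀ s ∈ Icc (t i) (t (i + 1)), f s - f (t i) = m i * (s - t i))
    (hm : ∀ i ≤ n, |m i - μ| ≤ ε) {s : ℝ} (hs : s ∈ Icc (t 0) (t (n + 1))) :
    |f s - f (t 0) - μ * (s - t 0)| ≤ ε * (s - t 0) := by
  have hpiece : ∀ i ≤ n, ∀ s ∈ Icc (t i) (t (i + 1)),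
      |f s - f (t i) - μ * (s - t i)| ≤ ε * (s - t i) := fun i hi s hs => by
    rw [hf i hi s hs, ← sub_mul, abs_mul, abs_of_nonneg (sub_nonneg.mpr hs.1)]
    exact mul_le_mul_of_nonneg_right (hm i hi) (sub_nonneg.mpr hs.1)
  have hconcat : ∀ r s u : ℝ, |f s - f r - μ * (s - r)| ≤ ε * (s - r) →
      |f u - f s - μ * (u - s)| ≤ ε * (u - s) → |f u - f r - μ * (u - r)| ≤ ε * (u - r) :=
    fun r s u hrs hsu => by
      rw [abs_le] at *
      constructor <;> linarith
  have hnode : ∀ i ≤ n + 1, |f (t i) - f (t 0) - μ * (t i - t 0)| ≤ ε * (t i - t 0) := by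
    intro i
    induction i with
    | zero => simp
    | succ i ih =>
      exact fun hi => hconcat _ _ _ (ih (by omega))
        (hpiece i (by omega) _ (right_mem_Icc.mpr (ht i.le_succ)))
  obtain ⟨i, hi, hsi⟩ := exists_mem_Icc_succ n hs
  exact hconcat _ _ _ (hnode i (by omega)) (hpiece i hi s hsi)

variable {𝒯 : Complex2} {Ω : Set Plane} {h : ℝ}

lemma ne_of_mem_elements {a b c : Plane} (hT : {a, b, c} ∈ elements 𝒯) :
    a ≠ b ∧ a ≠ c ∧ b ≠ c := by
  obtain ⟨s, -, hcard, hs⟩ := hT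
  have hnot_subset : ∀ x y : Plane, ¬ ({a, b, c} : Set Plane) ⊆ {x, y} := fun x y hsub => by
    have hle := Finset.card_le_card (t := {x, y}) (s := s) (fun z hz => by
      simpa using hsub (hs ▸ Finset.mem_coe.mpr hz))
    have := Finset.card_le_two (a := x) (b := y)
    omega
  refine ⟨?_, ?_, ?_⟩ <;> rintro rfl
  · exact hnot_subset a c (by simp)
  · exact hnot_subset a b (by simp [insert_subset_iff])
  · exact hnot_subset a b (by simp)

lemma ne_add_smul_of_mem_elements {a b c : Plane} (hT : {a, b, c} ∈ elements 𝒯) (t : ℝ) :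
    c ≠ a + t • (b - a) := by
  obtain ⟨-, hac, hbc⟩ := ne_of_mem_elements hT
  rintro hc
  refine notMem_affineSpan_of_mem_elements hT (x := c) (by simp) ?_
  have hline : AffineMap.lineMap a b t ∈ affineSpan ℝ (({a, b, c} : Set Plane) \ {c}) :=
    AffineMap.lineMap_mem _ (subset_affineSpan ℝ _ ⟨by simp, hac⟩)
      (subset_affineSpan ℝ _ ⟨by simp, hbc⟩)
  rwa [AffineMap.lineMap_apply, vsub_eq_sub, vadd_eq_add, add_comm, ← hc] at hline

lemma IsGradOn.inner_sub_eq_zero {U : Plane → ℝ} {T T' : Set Plane} {w w' x y : Plane}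
    (hw : IsGradOn U T w) (hw' : IsGradOn U T' w') (hx : x ∈ T) (hy : y ∈ T) (hx' : x ∈ T')
    (hy' : y ∈ T') : inner ℝ (w - w') (x - y) = 0 := by
  rw [inner_sub_left, ← hw x (subset_convexHull ℝ _ hx) y (subset_convexHull ℝ _ hy),
    ← hw' x (subset_convexHull ℝ _ hx') y (subset_convexHull ℝ _ hy'), sub_self]

namespace Band

variable (B : Band 𝒯) {i j : ℕ} {s : ℝ}

/-- The vertex set of the triangle `K i` of the band. -/
def K (i : ℕ) : Set Plane := {B.p i, B.p (i + 1), B.q i}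

/-- The vertex set of the triangle `K̃ (i+1)` of the band; like `ang'` and `areaK'`, it is indexed
from `0`. -/
def K' (i : ℕ) : Set Plane := {B.q i, B.q (i + 1), B.p (i + 1)}

/-- The arc length parameter of `p i` on the edge `Γ` of the band. -/
def pos (i : ℕ) : ℝ := ∑ j ∈ Finset.range i, dist (B.p j) (B.p (j + 1))

lemma pos_zero : B.pos 0 = 0 := Finset.sum_range_zero _

lemma pos_succ (i : ℕ) : B.pos (i + 1) = B.pos i + dist (B.p i) (B.p (i + 1)) :=
  Finset.sum_range_succ _ _

lemma monotone_pos : Monotone B.pos :=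
  monotone_nat_of_le_succ fun i => B.pos_succ i ▸ le_add_of_nonneg_right dist_nonneg

lemma K_mem (hi : i ≤ B.N) : B.K i ∈ elements 𝒯 := B.elem_mem i hi

lemma K'_mem (hi : i < B.N) : B.K' i ∈ elements 𝒯 := B.elem'_mem i hi

lemma dist_p_pos (hi : i ≤ B.N) : 0 < dist (B.p i) (B.p (i + 1)) :=
  dist_pos.mpr (ne_of_mem_elements (B.K_mem hi)).1

lemma p_succ_sub (hi : i ≤ B.N) :
    B.p (i + 1) - B.p i = dist (B.p i) (B.p (i + 1)) • B.g :=
  sub_eq_iff_eq_add'.mpr (B.straight i hi)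

lemma p_eq_add_pos_smul (hi : i ≤ B.N + 1) : B.p i = B.p 0 + B.pos i • B.g := by
  induction i with
  | zero => rw [pos_zero, zero_smul, add_zero]
  | succ i ih =>
    rw [pos_succ, add_smul, ← add_assoc, ← ih (by omega)]
    exact B.straight i (by omega)

lemma length_eq_pos : B.length = B.pos (B.N + 1) := by
  rw [length, B.p_eq_add_pos_smul le_rfl, dist_eq_norm, sub_add_cancel_left, norm_neg, norm_smul,
    B.norm_g, mul_one, Real.norm_of_nonneg (B.pos_zero ▸ B.monotone_pos (Nat.zero_le _))]

lemma eq_of_p_eq (hi : i ≤ B.N + 1) (hj : j ≤ B.N + 1) (hp : B.p i = B.p j) : i = j := by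
  have hg : B.g ≠ 0 := norm_pos_iff.mp (B.norm_g ▸ one_pos)
  rw [B.p_eq_add_pos_smul hi, B.p_eq_add_pos_smul hj, add_right_inj] at hp
  have hpos : StrictMonoOn B.pos (Iic (B.N + 1)) := strictMonoOn_of_lt_succ ordConnected_Iic
    fun i _ _ hi => B.pos_succ i ▸ lt_add_of_pos_right _ (B.dist_p_pos (Nat.succ_le_succ_iff.mp hi))
  exact hpos.injOn hi hj (smul_left_injective ℝ hg hp)

lemma q_ne_p (hi : i ≤ B.N) (hj : j ≤ B.N + 1) : B.q i ≠ B.p j := by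
  intro hq
  refine ne_add_smul_of_mem_elements (B.K_mem hi)
    ((B.pos j - B.pos i) / dist (B.p i) (B.p (i + 1))) ?_
  rw [B.p_succ_sub hi, smul_smul, div_mul_cancel₀ _ (B.dist_p_pos hi).ne', hq,
    B.p_eq_add_pos_smul hj, B.p_eq_add_pos_smul (i := i) (by omega)]
  module

lemma eq_of_K_eq (hi : i ≤ B.N) (hj : j ≤ B.N) (hij : B.K i = B.K j) : i = j := by
  have hle : ∀ {i j}, i ≤ B.N → j ≤ B.N → B.K i = B.K j → j ≤ i := by
    intro i j hi hj hij
    rcases (hij ▸ Or.inl rfl : B.p i ∈ B.K j) with h | h | h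
    · exact (B.eq_of_p_eq (by omega) (by omega) h).ge
    · have := B.eq_of_p_eq (by omega) (by omega) h
      omega
    · exact absurd (mem_singleton_iff.mp h).symm (B.q_ne_p hj (by omega))
  exact le_antisymm (hle hj hi hij.symm) (hle hi hj hij)

lemma eq_of_K'_eq (hi : i < B.N) (hj : j < B.N) (hij : B.K' i = B.K' j) : i = j := by
  rcases (hij ▸ Or.inr (Or.inr rfl) : B.p (i + 1) ∈ B.K' j) with h | h | h
  · exact absurd h.symm (B.q_ne_p (by omega) (by omega))
  · exact absurd h.symm (B.q_ne_p (by omega) (by omega))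
  · exact Nat.succ_injective (B.eq_of_p_eq (by omega) (by omega) (mem_singleton_iff.mp h))

lemma add_smul_mem_convexHull (hi : i ≤ B.N) (hs : s ∈ Icc (B.pos i) (B.pos (i + 1))) :
    B.p 0 + s • B.g ∈ convexHull ℝ (B.K i) := by
  have hd := B.dist_p_pos hi
  have hs₁ := hs.2
  rw [pos_succ] at hs₁
  have hseg : B.p 0 + s • B.g ∈ segment ℝ (B.p i) (B.p (i + 1)) := by
    rw [segment_eq_image']
    refine ⟨(s - B.pos i) / dist (B.p i) (B.p (i + 1)),
      ⟨div_nonneg (sub_nonneg.mpr hs.1) hd.le, (div_le_one hd).mpr (by linarith)⟩, ?_⟩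
    simp only [B.p_succ_sub hi, smul_smul]
    rw [div_mul_cancel₀ _ hd.ne', B.p_eq_add_pos_smul (i := i) (by omega)]
    module
  exact segment_subset_convexHull (by simp [K]) (by simp [K]) hseg

lemma add_smul_mem_closure (h𝒯 : IsTriangulation Ω 𝒯 h) (hs : s ∈ Icc 0 B.length) :
    B.p 0 + s • B.g ∈ closure Ω := by
  rw [length_eq_pos, ← B.pos_zero] at hs
  obtain ⟨i, hi, hsi⟩ := exists_mem_Icc_succ _ hs
  exact h𝒯.convexHull_subset_closure (B.K_mem hi) (B.add_smul_mem_convexHull hi hsi)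

/-- The jump of the derivative of `U` in the direction of the band between `K i` and `K (i+1)`,
where `w` assigns to each triangle the gradient of `U` on it. -/
def jump (w : Set Plane → Plane) (i : ℕ) : ℝ := inner ℝ (w (B.K (i + 1)) - w (B.K i)) B.g

variable {U : Plane → ℝ} {w : Set Plane → Plane} (hw : ∀ T ∈ elements 𝒯, IsGradOn U T (w T))
include hw

lemma abs_sub_sub_mul_le_sum_abs_jump (hs : s ∈ Icc 0 B.length) :
    |U (B.p 0 + s • B.g) - U (B.p 0) - inner ℝ (w (B.K 0)) B.g * s| ≤
      (∑ i ∈ Finset.range B.N, |B.jump w i|) * s := by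
  rw [length_eq_pos, ← B.pos_zero] at hs
  have hslope : ∀ i ≤ B.N, |inner ℝ (w (B.K i)) B.g - inner ℝ (w (B.K 0)) B.g| ≤
      ∑ i ∈ Finset.range B.N, |B.jump w i| := fun i hi =>
    calc |inner ℝ (w (B.K i)) B.g - inner ℝ (w (B.K 0)) B.g|
        = |∑ j ∈ Finset.range i, B.jump w j| := by
          rw [← Finset.sum_range_sub (fun j => inner ℝ (w (B.K j)) B.g)]
          simp only [jump, inner_sub_left]
      _ ≤ ∑ j ∈ Finset.range i, |B.jump w j| := Finset.abs_sum_le_sum_abs _ _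
      _ ≤ ∑ j ∈ Finset.range B.N, |B.jump w j| :=
          Finset.sum_le_sum_of_subset_of_nonneg (Finset.range_mono hi) fun _ _ _ => abs_nonneg _
  have hlinear : ∀ i ≤ B.N, ∀ s ∈ Icc (B.pos i) (B.pos (i + 1)),
      U (B.p 0 + s • B.g) - U (B.p 0 + B.pos i • B.g) =
        inner ℝ (w (B.K i)) B.g * (s - B.pos i) := fun i hi s hs => by
    rw [hw _ (B.K_mem hi) _ (B.add_smul_mem_convexHull hi hs) _
      (B.add_smul_mem_convexHull hi (left_mem_Icc.mpr (B.monotone_pos i.le_succ))),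
      add_sub_add_left_eq_sub, ← sub_smul, inner_smul_right, mul_comm]
  simpa [pos_zero] using abs_sub_sub_mul_le_of_slopes B.monotone_pos
    (f := fun s => U (B.p 0 + s • B.g)) hlinear hslope hs

lemma abs_jump_le {C_α : ℝ} (hi : i < B.N) (hα : sin (π - B.ang i) ≤ C_α * sin (π - B.ang' i)) :
    |B.jump w i| ≤ sin (π - B.ang' i) *
      (C_α * ‖w (B.K' i) - w (B.K i)‖ + (1 + C_α) * ‖w (B.K' i) - w (B.K (i + 1))‖) := by
  have hKi := B.K_mem hi.le
  have hK' := B.K'_mem hi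
  have hneg : B.p i - B.p (i + 1) = (-dist (B.p i) (B.p (i + 1))) • B.g := by
    rw [← neg_sub, B.p_succ_sub hi.le, neg_smul]
  have hangle : sin (angle (B.q i - B.p (i + 1)) B.g) = sin (∠ (B.p i) (B.p (i + 1)) (B.q i)) := by
    rw [EuclideanGeometry.angle, vsub_eq_sub, vsub_eq_sub, hneg,
      angle_smul_left_of_neg _ _ (neg_neg_of_pos (B.dist_p_pos hi.le)), angle_neg_left, sin_pi_sub,
      angle_comm]
  refine abs_inner_sub_le_of_orthogonal B.norm_g
    ((hw _ hK').inner_sub_eq_zero (hw _ hKi) (x := B.q i) (y := B.p (i + 1)) ?_ ?_ ?_ ?_)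
    ((hw _ hK').inner_sub_eq_zero (hw _ (B.K_mem hi)) (x := B.q (i + 1)) (y := B.p (i + 1))
      ?_ ?_ ?_ ?_) ?_ ?_
  iterate 8 simp [K, K']
  · rw [ang', ← B.maxAngle_eq' i hi, sin_pi_sub]
    rfl
  · rw [hangle]
    refine (sin_angle_le_sin_maxAngle (ne_of_mem_elements hKi).1).trans ?_
    rwa [ang, sin_pi_sub] at hα

end Band

end Bands

section LongBands

variable {Ω : Set Plane} {𝒯 : Complex2} {h : ℝ} {U : Plane → ℝ}

lemma Band.length_le_diam_closure (h𝒯 : IsTriangulation Ω 𝒯 h) (hΩ : Bornology.IsBounded Ω)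
    (B : Band 𝒯) : B.length ≤ Metric.diam (closure Ω) := by
  have hp : ∀ i ≤ B.N + 1, B.pos i ∈ Icc 0 B.length := fun i hi => by
    rw [length_eq_pos, ← B.pos_zero]
    exact ⟨B.monotone_pos i.zero_le, B.monotone_pos hi⟩
  have hmem : ∀ i ≤ B.N + 1, B.p i ∈ closure Ω := fun i hi => by
    rw [B.p_eq_add_pos_smul hi]
    exact B.add_smul_mem_closure h𝒯 (hp i hi)
  exact Metric.dist_le_diam_of_mem hΩ.closure (hmem 0 (Nat.zero_le _)) (hmem _ le_rfl)

lemma IsLipschitzOpen.exists_mul_length_le_sum_abs_jump (hΩ : IsLipschitzOpen Ω) :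
    ∃ C c : ℝ, 0 < C ∧ 0 < c ∧ ∀ (𝒯 : Complex2) (h : ℝ), IsTriangulation Ω 𝒯 h →
      ∀ U ∈ feSpace 𝒯, ∀ w : Set Plane → Plane, (∀ T ∈ elements 𝒯, IsGradOn U T (w T)) →
      ∀ B : Band 𝒯, C * h1Seminorm Ω (err U) ≤ B.length ^ 2 →
      c * B.length ≤ ∑ i ∈ Finset.range B.N, |B.jump w i| := by
  obtain ⟨ρ, C, hρ, hC, hsegment⟩ := hΩ.exists_sq_norm_le_of_almost_linear
  set D := Metric.diam (closure Ω)
  have : 0 ≤ D := Metric.diam_nonneg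
  set σ := min 1 (ρ / (D + 1))
  have : 0 < σ := lt_min one_pos (by positivity)
  refine ⟨2 * C / σ ^ 2, σ / 60, by positivity, by positivity, ?_⟩
  intro 𝒯 h h𝒯 U hU w hw B hL
  by_contra! hlt
  have hL₀ : 0 < B.length :=
    pos_of_mul_pos_right ((Finset.sum_nonneg fun _ _ => abs_nonneg _).trans_lt hlt) (by positivity)
  have hσL : σ * B.length ≤ B.length := mul_le_of_le_one_left hL₀.le (min_le_left _ _)
  have hnorm : ‖(σ * B.length) • B.g‖ = σ * B.length := by
    rw [norm_smul, B.norm_g, mul_one, Real.norm_of_nonneg (by positivity)]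
  have hshort : ‖(σ * B.length) • B.g‖ < ρ := by
    have hLD := B.length_le_diam_closure h𝒯 hΩ.isBounded
    calc ‖(σ * B.length) • B.g‖ ≤ ρ / (D + 1) * B.length := by
          rw [hnorm]
          gcongr
          exact min_le_right _ _
      _ < ρ / (D + 1) * (D + 1) := by gcongr; linarith
      _ = ρ := div_mul_cancel₀ _ (by positivity)
  have hmem : ∀ s ∈ Icc (0 : ℝ) 1, s * (σ * B.length) ∈ Icc 0 B.length := fun s hs =>
    ⟨mul_nonneg hs.1 (by positivity), (mul_le_of_le_one_left (by positivity) hs.2).trans hσL⟩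
  have hsq := hsegment 𝒯 h h𝒯 U hU (B.p 0) ((σ * B.length) • B.g)
    (inner ℝ (w (B.K 0)) B.g * (σ * B.length)) hshort
    (fun s hs => by
      rw [smul_smul]
      exact B.add_smul_mem_closure h𝒯 (hmem s hs))
    (fun s hs => by
      have hjump := B.abs_sub_sub_mul_le_sum_abs_jump hw (hmem s hs)
      rw [smul_smul, hnorm, mul_assoc, mul_comm (σ * B.length)]
      calc _ ≤ _ := hjump
        _ ≤ σ / 60 * B.length * (1 * (σ * B.length)) := by
            have hs₁ := hs.2
            have hs₀ := (hmem s hs).1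
            gcongr
        _ = (σ * B.length) ^ 2 / 60 := by ring)
  rw [hnorm, mul_pow] at hsq
  rw [div_mul_eq_mul_div, div_le_iff₀ (by positivity)] at hL
  have : 0 < σ ^ 2 * B.length ^ 2 := by positivity
  linarith

end LongBands

section BandEstimate

variable {Ω : Set Plane} {𝒯 : Complex2} {h : ℝ} {U : Plane → ℝ}

namespace Band

variable (B : Band 𝒯) {w : Set Plane → Plane} {C_K C_α : ℝ} {i : ℕ}

lemma areaK'_nonneg (i : ℕ) : 0 ≤ B.areaK' i := measureReal_nonneg

lemma sq_jump_div_sq_sin_le (hw : ∀ T ∈ elements 𝒯, IsGradOn U T (w T)) (hC_α : 0 ≤ C_α)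
    (hi : i < B.N) (hα : sin (π - B.ang i) ≤ C_α * sin (π - B.ang' i)) (x : Plane) :
    1 / sin (π - B.ang' i) ^ 2 * B.jump w i ^ 2 ≤ 12 * (1 + C_α) ^ 2 *
      (‖w (B.K' i) - x‖ ^ 2 + ‖w (B.K i) - x‖ ^ 2 + ‖w (B.K (i + 1)) - x‖ ^ 2) := by
  have hjump := B.abs_jump_le hw hi hα
  have h₀ := norm_sub_le_norm_sub_add_norm_sub (w (B.K' i)) x (w (B.K i))
  have h₁ := norm_sub_le_norm_sub_add_norm_sub (w (B.K' i)) x (w (B.K (i + 1)))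
  rw [norm_sub_rev x] at h₀ h₁
  set S := sin (π - B.ang' i)
  set r := ‖w (B.K' i) - x‖
  set r₀ := ‖w (B.K i) - x‖
  set r₁ := ‖w (B.K (i + 1)) - x‖
  set Y := C_α * ‖w (B.K' i) - w (B.K i)‖ + (1 + C_α) * ‖w (B.K' i) - w (B.K (i + 1))‖ with hY
  have hS : 1 / S ^ 2 * B.jump w i ^ 2 ≤ Y ^ 2 := by
    refine (one_div_mul_eq_div _ _).trans_le (div_le_of_le_mul₀ (sq_nonneg _) (sq_nonneg _) ?_)
    rw [mul_comm, ← mul_pow, ← sq_abs (B.jump w i)]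
    gcongr
  have hYle : Y ≤ (1 + C_α) * (2 * r + r₀ + r₁) :=
    calc Y ≤ (1 + C_α) * (r + r₀) + (1 + C_α) * (r + r₁) := by
          rw [hY]
          gcongr
          linarith
      _ = (1 + C_α) * (2 * r + r₀ + r₁) := by ring
  calc 1 / S ^ 2 * B.jump w i ^ 2 ≤ ((1 + C_α) * (2 * r + r₀ + r₁)) ^ 2 :=
        hS.trans (by gcongr)
    _ = (1 + C_α) ^ 2 * (2 * r + r₀ + r₁) ^ 2 := mul_pow _ _ _
    _ ≤ (1 + C_α) ^ 2 * (12 * (r ^ 2 + r₀ ^ 2 + r₁ ^ 2)) := by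
        gcongr
        nlinarith [sq_nonneg (2 * r - r₀), sq_nonneg (2 * r - r₁), sq_nonneg (r₀ - r₁)]
    _ = 12 * (1 + C_α) ^ 2 * (r ^ 2 + r₀ ^ 2 + r₁ ^ 2) := by ring

lemma areaK'_mul_sq_jump_le (hw : ∀ T ∈ elements 𝒯, IsGradOn U T (w T)) (hC_K : 0 ≤ C_K)
    (hC_α : 0 ≤ C_α) (hB : B.IsAdmissible C_K C_α) (hi : i < B.N) :
    1 / sin (π - B.ang' i) ^ 2 * B.areaK' i * B.jump w i ^ 2 ≤ 408 * (1 + C_α) ^ 2 *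
      (localEnergy U (B.K' i) + C_K * localEnergy U (B.K i) +
        C_K * localEnergy U (B.K (i + 1))) := by
  obtain ⟨hK₁, hK₀, hα⟩ := hB i hi
  have hK := B.K_mem hi.le
  set p := B.p (i + 1)
  have e : B.areaK' i * ‖w (B.K' i) - (2 : ℝ) • p‖ ^ 2 ≤ 34 * localEnergy U (B.K' i) :=
    (hw _ (B.K'_mem hi)).measureReal_mul_sq_norm_le (B.K'_mem hi)
      (subset_convexHull ℝ _ (by simp [K', p]))
  have e₀ : B.areaK i * ‖w (B.K i) - (2 : ℝ) • p‖ ^ 2 ≤ 34 * localEnergy U (B.K i) :=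
    (hw _ hK).measureReal_mul_sq_norm_le hK (subset_convexHull ℝ _ (by simp [K, p]))
  have e₁ : B.areaK (i + 1) * ‖w (B.K (i + 1)) - (2 : ℝ) • p‖ ^ 2 ≤
      34 * localEnergy U (B.K (i + 1)) :=
    (hw _ (B.K_mem hi)).measureReal_mul_sq_norm_le (B.K_mem hi)
      (subset_convexHull ℝ _ (by simp [K, p]))
  have hjump := B.sq_jump_div_sq_sin_le hw hC_α hi hα ((2 : ℝ) • p)
  set r := ‖w (B.K' i) - (2 : ℝ) • p‖
  set r₀ := ‖w (B.K i) - (2 : ℝ) • p‖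
  set r₁ := ‖w (B.K (i + 1)) - (2 : ℝ) • p‖
  calc 1 / sin (π - B.ang' i) ^ 2 * B.areaK' i * B.jump w i ^ 2
      = B.areaK' i * (1 / sin (π - B.ang' i) ^ 2 * B.jump w i ^ 2) := by ring
    _ ≤ B.areaK' i * (12 * (1 + C_α) ^ 2 * (r ^ 2 + r₀ ^ 2 + r₁ ^ 2)) :=
        mul_le_mul_of_nonneg_left hjump (B.areaK'_nonneg i)
    _ = 12 * (1 + C_α) ^ 2 *
          (B.areaK' i * r ^ 2 + B.areaK' i * r₀ ^ 2 + B.areaK' i * r₁ ^ 2) := by ring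
    _ ≤ 12 * (1 + C_α) ^ 2 * (B.areaK' i * r ^ 2 + C_K * B.areaK i * r₀ ^ 2 +
          C_K * B.areaK (i + 1) * r₁ ^ 2) := by gcongr
    _ = 12 * (1 + C_α) ^ 2 * (B.areaK' i * r ^ 2 + C_K * (B.areaK i * r₀ ^ 2) +
          C_K * (B.areaK (i + 1) * r₁ ^ 2)) := by ring
    _ ≤ 12 * (1 + C_α) ^ 2 * (34 * localEnergy U (B.K' i) + C_K * (34 * localEnergy U (B.K i)) +
          C_K * (34 * localEnergy U (B.K (i + 1)))) := by gcongr
    _ = 408 * (1 + C_α) ^ 2 * (localEnergy U (B.K' i) + C_K * localEnergy U (B.K i) +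
          C_K * localEnergy U (B.K (i + 1))) := by ring

lemma weight_le_of_mul_length_le {a : ℕ → ℝ} {c : ℝ} (hc : 0 < c)
    (hL : c * B.length ≤ ∑ i ∈ Finset.range B.N, |a i|) :
    B.weight ≤ (c ^ 2)⁻¹ * ∑ i ∈ Finset.range B.N,
      1 / sin (π - B.ang' i) ^ 2 * B.areaK' i * a i ^ 2 := by
  have hN : (0 : ℝ) < B.N := Nat.cast_pos.mpr B.one_le_N
  have hL₀ : 0 ≤ B.length := dist_nonneg
  set m₁ := ⨅ i : Fin B.N, 1 / sin (π - B.ang' i) ^ 2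
  set m₂ := ⨅ i : Fin B.N, B.areaK' i
  have hm₁ : 0 ≤ m₁ := Real.iInf_nonneg fun i => by positivity
  have hm₂ : 0 ≤ m₂ := Real.iInf_nonneg fun i => B.areaK'_nonneg i
  have hm₁_le : ∀ i < B.N, m₁ ≤ 1 / sin (π - B.ang' i) ^ 2 := fun i hi =>
    ciInf_le (finite_range _).bddBelow (⟨i, hi⟩ : Fin B.N)
  have hm₂_le : ∀ i < B.N, m₂ ≤ B.areaK' i := fun i hi =>
    ciInf_le (finite_range _).bddBelow (⟨i, hi⟩ : Fin B.N)
  have hcauchy : (c * B.length) ^ 2 ≤ B.N * ∑ i ∈ Finset.range B.N, a i ^ 2 :=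
    calc (c * B.length) ^ 2 ≤ (∑ i ∈ Finset.range B.N, |a i|) ^ 2 := by gcongr
      _ ≤ B.N * ∑ i ∈ Finset.range B.N, a i ^ 2 := by
          simpa only [Finset.card_range, sq_abs] using
            sq_sum_le_card_mul_sum_sq (s := Finset.range B.N) (f := fun i => |a i|)
  calc B.weight = m₁ * m₂ * ((c ^ 2)⁻¹ * ((c * B.length) ^ 2 * (B.N : ℝ)⁻¹)) := by
        rw [show B.weight = m₁ * m₂ * B.length ^ 2 * (B.N : ℝ)⁻¹ from rfl]
        field_simp
    _ ≤ m₁ * m₂ * ((c ^ 2)⁻¹ * (B.N * (∑ i ∈ Finset.range B.N, a i ^ 2) * (B.N : ℝ)⁻¹)) := by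
        gcongr
    _ = (c ^ 2)⁻¹ * ∑ i ∈ Finset.range B.N, m₁ * m₂ * a i ^ 2 := by
        rw [← Finset.mul_sum]
        field_simp
    _ ≤ _ := by
        gcongr with i hi
        exacts [hm₁_le i (Finset.mem_range.mp hi), hm₂_le i (Finset.mem_range.mp hi)]

lemma elems_subset_elements : B.elems ⊆ elements 𝒯 := by
  rintro T (⟨i, hi, rfl⟩ | ⟨i, hi, rfl⟩)
  exacts [B.K_mem hi, B.K'_mem hi]

end Band

lemma DisjointBands.sum_localEnergy_le {n : ℕ} {B : Fin n → Band 𝒯} (hB : DisjointBands B)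
    (h𝒯 : IsTriangulation Ω 𝒯 h) (hΩ : IsLipschitzOpen Ω) (hU : U ∈ feSpace 𝒯)
    {T : Fin n → ℕ → Set Plane} (hT : ∀ b, ∀ i < (B b).N, T b i ∈ (B b).elems)
    (hinj : ∀ b, InjOn (T b) (Iio (B b).N)) :
    ∑ b, ∑ i ∈ Finset.range (B b).N, localEnergy U (T b i) ≤ h1Seminorm Ω (err U) ^ 2 := by
  simp only [Finset.sum_range, ← Fintype.sum_sigma']
  refine h𝒯.sum_localEnergy_le hΩ hU (T := fun x : Σ b, Fin (B b).N => T x.1 x.2)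
    (fun x => (B x.1).elems_subset_elements (hT x.1 x.2 x.2.2)) ?_
  rintro ⟨b, i⟩ ⟨b', j⟩ (hij : T b i = T b' j)
  obtain rfl : b = b' := by
    by_contra hne
    exact disjoint_left.mp (hB hne) (hT b i i.2) (hij.symm ▸ hT b' j j.2 : T b i ∈ _)
  exact congrArg _ (Fin.ext (hinj b i.2 j.2 hij))

lemma exists_forall_isGradOn (hU : U ∈ feSpace 𝒯) :
    ∃ w : Set Plane → Plane, ∀ T ∈ elements 𝒯, IsGradOn U T (w T) := by
  choose! w hw using fun T (hT : T ∈ elements 𝒯) => exists_isGradOn hU hT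
  exact ⟨w, hw⟩

lemma IsLipschitzOpen.exists_sqrt_sum_weight_le (hΩ : IsLipschitzOpen Ω) :
    ∃ C₀ : ℝ, 0 < C₀ ∧ ∀ C_K C_α : ℝ, 0 < C_K → 0 < C_α → ∃ C : ℝ, 0 < C ∧
      ∀ (𝒯 : Complex2) (h : ℝ), IsTriangulation Ω 𝒯 h → ∀ U ∈ feSpace 𝒯,
      ∀ (n : ℕ) (B : Fin n → Band 𝒯), DisjointBands B → (∀ b, (B b).IsAdmissible C_K C_α) →
      (∀ b, C₀ * h1Seminorm Ω (err U) ≤ (B b).length ^ 2) →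
      √(∑ b, (B b).weight) ≤ C * h1Seminorm Ω (err U) := by
  obtain ⟨C₀, c, hC₀, hc, hjump⟩ := hΩ.exists_mul_length_le_sum_abs_jump
  refine ⟨C₀, hC₀, fun C_K C_α hC_K hC_α => ?_⟩
  set X := (c ^ 2)⁻¹ * (408 * (1 + C_α) ^ 2 * (1 + 2 * C_K)) with hX
  refine ⟨√X, Real.sqrt_pos.mpr (by positivity), fun 𝒯 h h𝒯 U hU n B hdisj hadm hL => ?_⟩
  obtain ⟨w, hw⟩ := exists_forall_isGradOn hU
  set E := h1Seminorm Ω (err U)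
  have hE : 0 ≤ E := Real.sqrt_nonneg _
  have hsum' : ∑ b, ∑ i ∈ Finset.range (B b).N, localEnergy U ((B b).K' i) ≤ E ^ 2 :=
    hdisj.sum_localEnergy_le h𝒯 hΩ hU (fun b i hi => Or.inr ⟨i, hi, rfl⟩)
      fun b i hi j hj => (B b).eq_of_K'_eq hi hj
  have hsum₀ : ∑ b, ∑ i ∈ Finset.range (B b).N, localEnergy U ((B b).K i) ≤ E ^ 2 :=
    hdisj.sum_localEnergy_le h𝒯 hΩ hU (fun b i hi => Or.inl ⟨i, hi.le, rfl⟩)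
      fun b i hi j hj => (B b).eq_of_K_eq (le_of_lt hi) (le_of_lt hj)
  have hsum₁ : ∑ b, ∑ i ∈ Finset.range (B b).N, localEnergy U ((B b).K (i + 1)) ≤ E ^ 2 :=
    hdisj.sum_localEnergy_le h𝒯 hΩ hU (fun b i hi => Or.inl ⟨i + 1, hi, rfl⟩)
      fun b i hi j hj hij => Nat.succ_injective ((B b).eq_of_K_eq hi hj hij)
  have hmain : ∑ b, (B b).weight ≤ X * E ^ 2 :=
    calc ∑ b, (B b).weight ≤ ∑ b, (c ^ 2)⁻¹ * ∑ i ∈ Finset.range (B b).N,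
          408 * (1 + C_α) ^ 2 * (localEnergy U ((B b).K' i) +
            C_K * localEnergy U ((B b).K i) + C_K * localEnergy U ((B b).K (i + 1))) := by
          refine Finset.sum_le_sum fun b _ => ((B b).weight_le_of_mul_length_le hc
            (hjump 𝒯 h h𝒯 U hU w hw (B b) (hL b))).trans ?_
          refine mul_le_mul_of_nonneg_left (Finset.sum_le_sum fun i hi => ?_) (by positivity)
          exact (B b).areaK'_mul_sq_jump_le hw hC_K.le hC_α.le (hadm b) (Finset.mem_range.mp hi)
      _ = (c ^ 2)⁻¹ * (408 * (1 + C_α) ^ 2 *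
          (∑ b, ∑ i ∈ Finset.range (B b).N, localEnergy U ((B b).K' i) +
          C_K * ∑ b, ∑ i ∈ Finset.range (B b).N, localEnergy U ((B b).K i) +
          C_K * ∑ b, ∑ i ∈ Finset.range (B b).N, localEnergy U ((B b).K (i + 1)))) := by
          simp only [← Finset.mul_sum, Finset.sum_add_distrib]
      _ ≤ (c ^ 2)⁻¹ * (408 * (1 + C_α) ^ 2 * (E ^ 2 + C_K * E ^ 2 + C_K * E ^ 2)) := by gcongr
      _ = X * E ^ 2 := by rw [hX]; ring
  calc √(∑ b, (B b).weight) ≤ √(X * E ^ 2) := Real.sqrt_le_sqrt hmain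
    _ = √X * E := by rw [Real.sqrt_mul (by positivity), Real.sqrt_sq hE]

end BandEstimate

section Isosceles

variable {a b c a' b' c' : Plane} {h hbar : ℝ}

lemma IsIsosceles.norm_sq_left (hi : IsIsosceles a b c h hbar) :
    ‖a - c‖ ^ 2 = h ^ 2 / 4 + hbar ^ 2 := by
  obtain ⟨rfl, hlegs, rfl⟩ := hi
  have hmid : (2 : ℝ) • (midpoint ℝ a b - c) = (a - c) + (b - c) := by
    rw [midpoint_eq_smul_add, invOf_eq_inv]
    module
  have hparallelogram := parallelogram_law_with_norm ℝ (a - c) (b - c)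
  rw [dist_eq_norm, dist_eq_norm] at hlegs
  rw [← hmid, sub_sub_sub_cancel_right, norm_smul, Real.norm_two, ← hlegs] at hparallelogram
  rw [dist_eq_norm, dist_eq_norm]
  linarith

lemma IsIsosceles.norm_sq_right (hi : IsIsosceles a b c h hbar) :
    ‖b - c‖ ^ 2 = h ^ 2 / 4 + hbar ^ 2 := by
  rw [← hi.norm_sq_left, ← dist_eq_norm, ← dist_eq_norm, hi.2.1]

lemma IsIsosceles.inner_eq (hi : IsIsosceles a b c h hbar) :
    inner ℝ (a - c) (b - c) = hbar ^ 2 - h ^ 2 / 4 := by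
  have hbase : ‖(a - c) - (b - c)‖ ^ 2 = h ^ 2 := by
    rw [sub_sub_sub_cancel_right, ← dist_eq_norm, hi.1]
  rw [norm_sub_sq_real, hi.norm_sq_left, hi.norm_sq_right] at hbase
  linarith

lemma IsIsosceles.abs_cross (hi : IsIsosceles a b c h hbar) :
    |cross (a - c) (b - c)| = h * hbar := by
  have h₀ : 0 ≤ h * hbar := by
    rw [← hi.1, ← hi.2.2]
    positivity
  rw [← abs_of_nonneg h₀, ← sq_eq_sq_iff_abs_eq_abs, cross_sq, hi.norm_sq_left,
    hi.norm_sq_right, hi.inner_eq]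
  ring

lemma IsIsosceles.area_eq (hi : IsIsosceles a b c h hbar) : area a b c = h * hbar / 2 := by
  rw [area_eq_abs_cross_div_two, hi.abs_cross]

lemma IsIsosceles.sin_angle_mul (hi : IsIsosceles a b c h hbar) :
    sin (∠ a c b) * (h ^ 2 / 4 + hbar ^ 2) = h * hbar := by
  have hsin := sin_angle_mul_norm_mul_norm (a - c) (b - c)
  rw [real_inner_self_eq_norm_sq, real_inner_self_eq_norm_sq, ← sq (inner ℝ _ _),
    ← BandFEM.cross_sq, Real.sqrt_sq_eq_abs, hi.abs_cross, ← dist_eq_norm b, ← hi.2.1,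
    dist_eq_norm, ← sq, hi.norm_sq_left] at hsin
  exact hsin

lemma maxAngle_eq_of_dist_eq (hab : dist a b = dist a' b') (hac : dist a c = dist a' c')
    (hbc : dist b c = dist b' c') : maxAngle a b c = maxAngle a' b' c' := by
  have hcong := EuclideanGeometry.side_side_side hab hbc (by rwa [dist_comm c, dist_comm c'])
  exact congrArg₂ max (EuclideanGeometry.angle_eq_of_congruent hcong 1 0 2)
    (congrArg₂ max (EuclideanGeometry.angle_eq_of_congruent hcong 0 1 2)
      (EuclideanGeometry.angle_eq_of_congruent hcong 0 2 1))

lemma IsIsosceles.maxAngle_eq (hi : IsIsosceles a b c h hbar)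
    (hi' : IsIsosceles a' b' c' h hbar) : maxAngle a b c = maxAngle a' b' c' := by
  have hac : dist a c = dist a' c' := by
    rw [dist_eq_norm, dist_eq_norm, ← sq_eq_sq₀ (norm_nonneg _) (norm_nonneg _),
      hi.norm_sq_left, hi'.norm_sq_left]
  exact maxAngle_eq_of_dist_eq (hi.1.trans hi'.1.symm) hac (by rw [← hi.2.1, ← hi'.2.1, hac])

end Isosceles

section BabuskaAziz

namespace IsBabuskaAziz

variable {𝒯 : Complex2} {n : ℕ} {B : Fin n → Band 𝒯} {h hbar L : ℝ}

lemma isAdmissible (hB : IsBabuskaAziz B h hbar L) (b : Fin n) : (B b).IsAdmissible 1 1 := by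
  intro i hi
  have hK₀ := hB.isosceles b i hi.le
  have hK₁ := hB.isosceles b (i + 1) hi
  have hK' := hB.isosceles' b i hi
  refine ⟨?_, ?_, ?_⟩
  · rw [one_mul, Band.areaK', Band.areaK, hK'.area_eq, hK₁.area_eq]
  · rw [one_mul, Band.areaK', Band.areaK, hK'.area_eq, hK₀.area_eq]
  · rw [one_mul, Band.ang, Band.ang', hK₀.maxAngle_eq hK']

lemma length_eq_mul (hB : IsBabuskaAziz B h hbar L) (b : Fin n) : L = ((B b).N + 1) * h := by
  rw [← hB.length_eq b, Band.length_eq_pos, Band.pos, Finset.sum_congr rfl fun i hi =>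
    (hB.isosceles b i (Nat.lt_succ_iff.mp (Finset.mem_range.mp hi))).1]
  simp

lemma le_one_div_sq_sin_ang' (hB : IsBabuskaAziz B h hbar L) (hh : 0 < h) (hb : 0 < hbar)
    (b : Fin n) {i : ℕ} (hi : i < (B b).N) :
    h ^ 2 / (16 * hbar ^ 2) ≤ 1 / sin (π - (B b).ang' i) ^ 2 := by
  have hsin : sin ((B b).ang' i) * (h ^ 2 / 4 + hbar ^ 2) = h * hbar := by
    rw [Band.ang', ← (B b).maxAngle_eq' i hi]
    exact (hB.isosceles' b i hi).sin_angle_mul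
  rw [sin_pi_sub]
  set S := sin ((B b).ang' i)
  have hS : 0 < S := pos_of_mul_pos_left (hsin ▸ mul_pos hh hb) (by positivity)
  have hle : S * h ≤ 4 * hbar := by
    refine le_of_mul_le_mul_right ?_ hh
    calc S * h * h ≤ S * h * h + 4 * (S * hbar ^ 2) := by
          linarith [mul_nonneg hS.le (sq_nonneg hbar)]
      _ = 4 * hbar * h := by linear_combination 4 * hsin
  rw [div_le_div_iff₀ (by positivity) (by positivity)]
  calc h ^ 2 * S ^ 2 = (S * h) ^ 2 := by ring
    _ ≤ (4 * hbar) ^ 2 := by gcongr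
    _ = 1 * (16 * hbar ^ 2) := by ring

lemma le_weight (hB : IsBabuskaAziz B h hbar L) (hh : 0 < h) (hb : 0 < hbar) (b : Fin n) :
    h ^ 4 * L / (32 * hbar) ≤ (B b).weight := by
  have hN : (0 : ℝ) < (B b).N := Nat.cast_pos.mpr (B b).one_le_N
  have : Nonempty (Fin (B b).N) := ⟨⟨0, (B b).one_le_N⟩⟩
  have hL := hB.length_eq_mul b
  have hsin : h ^ 2 / (16 * hbar ^ 2) ≤
      ⨅ i : Fin (B b).N, 1 / sin (π - (B b).ang' i) ^ 2 :=
    le_ciInf fun i => hB.le_one_div_sq_sin_ang' hh hb b i.2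
  have harea : h * hbar / 2 ≤ ⨅ i : Fin (B b).N, (B b).areaK' i :=
    le_ciInf fun i => (hB.isosceles' b i i.2).area_eq.ge
  have hlength : h * L ≤ L ^ 2 * ((B b).N : ℝ)⁻¹ := by
    rw [← div_eq_mul_inv, le_div_iff₀ hN, hL]
    nlinarith [mul_pos hN (pow_pos hh 2), pow_pos hh 2]
  have := (by positivity : (0 : ℝ) ≤ h ^ 2 / (16 * hbar ^ 2)).trans hsin
  have := (by positivity : (0 : ℝ) ≤ h * hbar / 2).trans harea
  have : 0 ≤ L := by
    rw [hL]
    positivity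
  calc h ^ 4 * L / (32 * hbar) = h ^ 2 / (16 * hbar ^ 2) * (h * hbar / 2) * (h * L) := by
        field_simp
        ring
    _ ≤ (⨅ i : Fin (B b).N, 1 / sin (π - (B b).ang' i) ^ 2) *
        (⨅ i : Fin (B b).N, (B b).areaK' i) * (L ^ 2 * ((B b).N : ℝ)⁻¹) := by gcongr
    _ = (B b).weight := by rw [Band.weight, hB.length_eq b, mul_assoc _ (L ^ 2)]

lemma sq_mul_length_le (hB : IsBabuskaAziz B h hbar L) (hh : 0 < h) (hb : 0 < hbar) :
    h ^ 2 * L ≤ 6 * hbar * √(∑ b, (B b).weight) := by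
  have hsum : (h ^ 2 * L / (6 * hbar)) ^ 2 ≤ ∑ b, (B b).weight :=
    calc (h ^ 2 * L / (6 * hbar)) ^ 2 = h ^ 4 * L ^ 2 / (36 * hbar ^ 2) := by
          rw [div_pow]
          ring
      _ ≤ h ^ 4 * L ^ 2 / (32 * hbar ^ 2) := by
          gcongr
          norm_num
      _ = n * (h ^ 4 * L / (32 * hbar)) := by
          rw [sq L, ← hB.count]
          field_simp
      _ = ∑ _b : Fin n, h ^ 4 * L / (32 * hbar) := by simp
      _ ≤ ∑ b, (B b).weight := Finset.sum_le_sum fun b _ => hB.le_weight hh hb b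
  rw [← div_le_iff₀' (by positivity)]
  exact Real.le_sqrt_of_sq_le hsum

lemma le_height (hB : IsBabuskaAziz B h hbar L) (hh : 0 < h) (hL : 0 < L) {α C : ℝ} (hC : 0 < C)
    (hw : √(∑ b, (B b).weight) ≤ C * h ^ α) : 1 / (6 * C) * h ^ (2 - α) * L ≤ hbar := by
  have hb : 0 < hbar := pos_of_mul_pos_right (hB.count ▸ hL) n.cast_nonneg
  have hle : h ^ 2 * L ≤ hbar * (6 * C * h ^ α) :=
    calc h ^ 2 * L ≤ 6 * hbar * √(∑ b, (B b).weight) := hB.sq_mul_length_le hh hb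
      _ ≤ 6 * hbar * (C * h ^ α) := by gcongr
      _ = hbar * (6 * C * h ^ α) := by ring
  calc 1 / (6 * C) * h ^ (2 - α) * L = h ^ 2 * L / (6 * C * h ^ α) := by
        rw [rpow_sub hh, rpow_two]
        field_simp
    _ ≤ hbar := div_le_of_le_mul₀ (by positivity) hb.le hle

end IsBabuskaAziz

end BabuskaAziz

section Scaling

lemma mul_rpow_le_sq_of_mul_rpow_le {A D L h α : ℝ} (hh : 0 < h) (hLD : L ≤ D)
    (hL : (1 + A ^ 2 * D) * h ^ (2 * α / 5) ≤ L) (hL₀ : 0 < L) : A * h ^ α ≤ L ^ 2 := by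
  have hD : 0 < D := hL₀.trans_le hLD
  have hr : (h ^ (2 * α / 5)) ^ 5 = (h ^ α) ^ 2 := by
    rw [← rpow_mul_natCast hh.le, ← rpow_mul_natCast hh.le]
    congr 1
    push_cast
    ring
  set r := h ^ (2 * α / 5)
  have : 0 < r := rpow_pos_of_pos hh _
  have hone : 1 ≤ 1 + A ^ 2 * D := le_add_of_nonneg_right (by positivity)
  refine abs_le_of_sq_le_sq' ?_ (sq_nonneg L) |>.2
  refine le_of_mul_le_mul_left ?_ hD
  calc D * (A * h ^ α) ^ 2 = A ^ 2 * D * r ^ 5 := by rw [hr]; ring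
    _ ≤ (1 + A ^ 2 * D) * r ^ 5 := by gcongr; linarith
    _ ≤ (1 + A ^ 2 * D) ^ 5 * r ^ 5 := by gcongr; exact le_self_pow₀ hone (by norm_num)
    _ = ((1 + A ^ 2 * D) * r) ^ 5 := (mul_pow _ _ _).symm
    _ ≤ L ^ 5 := by gcongr
    _ = L * (L ^ 2) ^ 2 := by ring
    _ ≤ D * (L ^ 2) ^ 2 := by gcongr

lemma exists_forall_lt_mul_rpow_le {C p ℓ : ℝ} (hC : 0 < C) (hp : 0 < p) (hℓ : 0 < ℓ) :
    ∃ h₁ : ℝ, 0 < h₁ ∧ ∀ h, 0 < h → h < h₁ → C * h ^ p ≤ ℓ := by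
  refine ⟨(ℓ / C) ^ p⁻¹, by positivity, fun h hh hlt => ?_⟩
  rw [← le_div_iff₀' hC]
  exact (le_rpow_inv_iff_of_pos hh.le (by positivity) hp).mp hlt.le

lemma IsLipschitzOpen.exists_sqrt_sum_weight_le_rpow {Ω : Set Plane} (hΩ : IsLipschitzOpen Ω)
    (α : ℝ) {M : ℝ} (hM : 0 < M) :
    ∃ C_L : ℝ, 0 < C_L ∧ ∀ C_K C_α : ℝ, 0 < C_K → 0 < C_α → ∃ C : ℝ, 0 < C ∧
      ∀ (𝒯 : Complex2) (h : ℝ), 0 < h → IsTriangulation Ω 𝒯 h →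
      ∀ U ∈ feSpace 𝒯, h1Seminorm Ω (err U) ≤ M * h ^ α →
      ∀ (n : ℕ) (B : Fin n → Band 𝒯), DisjointBands B → (∀ b, (B b).IsAdmissible C_K C_α) →
      (∀ b, C_L * h ^ (2 * α / 5) ≤ (B b).length) → √(∑ b, (B b).weight) ≤ C * h ^ α := by
  obtain ⟨C₀, hC₀, hweight⟩ := hΩ.exists_sqrt_sum_weight_le
  set D := Metric.diam (closure Ω)
  have hC_L : 0 < 1 + (C₀ * M) ^ 2 * D :=
    add_pos_of_pos_of_nonneg one_pos (mul_nonneg (sq_nonneg _) Metric.diam_nonneg)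
  refine ⟨1 + (C₀ * M) ^ 2 * D, hC_L, fun C_K C_α hC_K hC_α => ?_⟩
  obtain ⟨C, hC, hweight⟩ := hweight C_K C_α hC_K hC_α
  refine ⟨C * M, mul_pos hC hM, fun 𝒯 h hh h𝒯 U hU hE n B hdisj hadm hL => ?_⟩
  have hlong : ∀ b, C₀ * h1Seminorm Ω (err U) ≤ (B b).length ^ 2 := fun b =>
    calc C₀ * h1Seminorm Ω (err U) ≤ C₀ * (M * h ^ α) := by gcongr
      _ = C₀ * M * h ^ α := (mul_assoc _ _ _).symm
      _ ≤ (B b).length ^ 2 := mul_rpow_le_sq_of_mul_rpow_le hh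
          ((B b).length_le_diam_closure h𝒯 hΩ.isBounded) (hL b)
          ((mul_pos hC_L (rpow_pos_of_pos hh _)).trans_le (hL b))
  calc √(∑ b, (B b).weight) ≤ C * h1Seminorm Ω (err U) := hweight 𝒯 h h𝒯 U hU n B hdisj hadm hlong
    _ ≤ C * (M * h ^ α) := by gcongr
    _ = C * M * h ^ α := (mul_assoc _ _ _).symm

end Scaling

end BandFEM

end

theorem corollary2p2_general (Ω : Set BandFEM.Plane) (hΩ : BandFEM.IsLipschitzOpen Ω)
    (α M : ℝ) (hM : 0 < M) :
    ∃ C_L : ℝ, 0 < C_L ∧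
      (∀ C_K C_α : ℝ, 0 < C_K → 0 < C_α → ∃ C : ℝ, 0 < C ∧
        ∀ (H : Set ℝ) (𝒯 : ℝ → BandFEM.Complex2),
          BandFEM.IsTriangulationFamily Ω H 𝒯 → BandFEM.ErrorEstimate Ω H 𝒯 α M →
          ∀ h ∈ H, ∀ (n : ℕ) (B : Fin n → BandFEM.Band (𝒯 h)),
            BandFEM.DisjointBands B →
            (∀ b, (B b).IsAdmissible C_K C_α) →
            (∀ b, C_L * h ^ (2 * α / 5) ≤ (B b).length) →
            Real.sqrt (∑ b, (B b).weight) ≤ C * h ^ α) ∧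
      (∃ c : ℝ, 0 < c ∧
        ∀ (H : Set ℝ) (𝒯 : ℝ → BandFEM.Complex2),
          BandFEM.IsTriangulationFamily Ω H 𝒯 → BandFEM.ErrorEstimate Ω H 𝒯 α M →
          ∀ h ∈ H, ∀ (n : ℕ) (B : Fin n → BandFEM.Band (𝒯 h)) (hbar L : ℝ),
            BandFEM.IsBabuskaAziz B h hbar L →
            C_L * h ^ (2 * α / 5) ≤ L →
            c * h ^ (2 - α) * L ≤ hbar) ∧
      (0 < α → ∀ ℓ : ℝ, 0 < ℓ → ∃ c h₁ : ℝ, 0 < c ∧ 0 < h₁ ∧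
        ∀ (H : Set ℝ) (𝒯 : ℝ → BandFEM.Complex2),
          BandFEM.IsTriangulationFamily Ω H 𝒯 → BandFEM.ErrorEstimate Ω H 𝒯 α M →
          ∀ h ∈ H, h < h₁ → ∀ (n : ℕ) (B : Fin n → BandFEM.Band (𝒯 h)) (hbar L : ℝ),
            BandFEM.IsBabuskaAziz B h hbar L →
            ℓ ≤ L →
            c * h ^ (2 - α) ≤ hbar) := by
  obtain ⟨C_L, hC_L, hweight⟩ := hΩ.exists_sqrt_sum_weight_le_rpow α hM
  have hBA : ∃ c : ℝ, 0 < c ∧ ∀ (H : Set ℝ) (𝒯 : ℝ → BandFEM.Complex2),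
      BandFEM.IsTriangulationFamily Ω H 𝒯 → BandFEM.ErrorEstimate Ω H 𝒯 α M →
      ∀ h ∈ H, ∀ (n : ℕ) (B : Fin n → BandFEM.Band (𝒯 h)) (hbar L : ℝ),
      BandFEM.IsBabuskaAziz B h hbar L → C_L * h ^ (2 * α / 5) ≤ L →
      c * h ^ (2 - α) * L ≤ hbar := by
    obtain ⟨C, hC, hweight⟩ := hweight 1 1 one_pos one_pos
    refine ⟨1 / (6 * C), by positivity, fun H 𝒯 h𝒯 ⟨U, hU⟩ h hh n B hbar L hB hL => ?_⟩
    have hL₀ : 0 < L := (mul_pos hC_L (Real.rpow_pos_of_pos (h𝒯 h hh).1 _)).trans_le hL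
    exact hB.le_height (h𝒯 h hh).1 hL₀ hC <| hweight _ h (h𝒯 h hh).1 (h𝒯 h hh).2 _ (hU h hh).1
      (hU h hh).2 n B hB.disjoint hB.isAdmissible fun b => hL.trans_eq (hB.length_eq b).symm
  refine ⟨C_L, hC_L, fun C_K C_α hC_K hC_α => ?_, hBA, fun hα ℓ hℓ => ?_⟩
  · obtain ⟨C, hC, hweight⟩ := hweight C_K C_α hC_K hC_α
    exact ⟨C, hC, fun H 𝒯 h𝒯 ⟨U, hU⟩ h hh =>
      hweight _ h (h𝒯 h hh).1 (h𝒯 h hh).2 _ (hU h hh).1 (hU h hh).2⟩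
  · obtain ⟨c, hc, hBA⟩ := hBA
    obtain ⟨h₁, hh₁, hsmall⟩ := BandFEM.exists_forall_lt_mul_rpow_le hC_L
      (by positivity : 0 < 2 * α / 5) hℓ
    refine ⟨c * ℓ, h₁, by positivity, hh₁, fun H 𝒯 h𝒯 hE h hh hlt n B hbar L hB hL => ?_⟩
    have hh₀ : 0 < h := (h𝒯 h hh).1
    calc c * ℓ * h ^ (2 - α) = c * h ^ (2 - α) * ℓ := by ring
      _ ≤ c * h ^ (2 - α) * L := by gcongr
      _ ≤ hbar := hBA H 𝒯 h𝒯 hE h hh n B hbar L hB ((hsmall h hh₀ hlt).trans hL)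

theorem corollary2p2 (Ω : Set BandFEM.Plane) (hΩ : BandFEM.IsPolygonalLipschitzDomain Ω)
    (α : ℝ) (hα : α ∈ Set.Icc (0 : ℝ) 1) (M : ℝ) (hM : 0 < M) :
    ∃ C_L : ℝ, 0 < C_L ∧
      -- the necessary condition for general sets of bands
      (∀ C_K C_α : ℝ, 0 < C_K → 0 < C_α → ∃ C : ℝ, 0 < C ∧
        ∀ (H : Set ℝ) (𝒯 : ℝ → BandFEM.Complex2),
          BandFEM.IsTriangulationFamily Ω H 𝒯 → BandFEM.ErrorEstimate Ω H 𝒯 α M →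
          ∀ h ∈ H, ∀ (n : ℕ) (B : Fin n → BandFEM.Band (𝒯 h)),
            BandFEM.DisjointBands B →
            (∀ b, (B b).IsAdmissible C_K C_α) →
            (∀ b, C_L * h ^ (2 * α / 5) ≤ (B b).length) →
            Real.sqrt (∑ b, (B b).weight) ≤ C * h ^ α) ∧
      -- Babuška–Aziz type sets of bands
      (∃ c : ℝ, 0 < c ∧
        ∀ (H : Set ℝ) (𝒯 : ℝ → BandFEM.Complex2),
          BandFEM.IsTriangulationFamily Ω H 𝒯 → BandFEM.ErrorEstimate Ω H 𝒯 α M →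
          ∀ h ∈ H, ∀ (n : ℕ) (B : Fin n → BandFEM.Band (𝒯 h)) (hbar L : ℝ),
            BandFEM.IsBabuskaAziz B h hbar L →
            C_L * h ^ (2 * α / 5) ≤ L →
            c * h ^ (2 - α) * L ≤ hbar) ∧
      -- Babuška–Aziz type sets of bands whose length is bounded below
      (0 < α → ∀ ℓ : ℝ, 0 < ℓ → ∃ c h₁ : ℝ, 0 < c ∧ 0 < h₁ ∧
        ∀ (H : Set ℝ) (𝒯 : ℝ → BandFEM.Complex2),
          BandFEM.IsTriangulationFamily Ω H 𝒯 → BandFEM.ErrorEstimate Ω H 𝒯 α M →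
          ∀ h ∈ H, h < h₁ → ∀ (n : ℕ) (B : Fin n → BandFEM.Band (𝒯 h)) (hbar L : ℝ),
            BandFEM.IsBabuskaAziz B h hbar L →
            ℓ ≤ L →
            c * h ^ (2 - α) ≤ hbar) := by
  exact corollary2p2_general Ω hΩ.isLipschitzOpen α M hM
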